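/- Let $p$ be a prime and let $G$ be a finitely presented pro-$p$ group. Put $d=\dim_{\mathbb F_p}H^1(G,\mathbb Z/p)$ and $r=\dim_{\mathbb F_p}H^2(G,\mathbb Z/p)$ (continuous cohomology, trivial action), and let $\varphi:F\twoheadrightarrow G$ be a minimal presentation of $G$, i.e. a continuous surjective homomorphism from a free pro-$p$ group $F$ on $d$ generators. For $x\in F$ let $\omega_F(x)=\sup\{n : x-1\in I^n\}\in\mathbb N\cup\{\infty\}$ be its depth, where $I$ is the augmentation ideal of the completed group algebra $\mathbb F_p[[F]]$. Suppose that $r<d^2/4$ and that $a:=2r/d>1$. Put $\lambda=\lfloor a\rfloor$ if $a\notin\mathbb Z$ and $\lambda=a-1$ if $a\in\mathbb Z$, and let $m\ge 2$ be an integer such that $$1-\frac{d^2}{4r}+\frac{(\lambda/a)^m}{1-\lambda/a}<0 .$$ For every $k\ge 0$ let $f_{j,k}\in F$, $1\le j\le\lambda^{k+m}$, be elements (not necessarily distinct) with $\omega_F(f_{j,k})\ge m+k$, and let $\langle f_{j,k}\rangle^{\mathrm N}$ be the closed normal subgroup of $F$ generated by all the $f_{j,k}$ ($k\ge0$, $1\le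 j\le\lambda^{k+m}$). Then the quotient $G/\varphi(\langle f_{j,k}\rangle^{\mathrm N})$ is infinite. -/

import Mathlib

universe u

namespace ProP

/-! ### Pro-`p` groups -/

/-- `G` is a pro-`p` group: a compact, Hausdorff, totally disconnected topological group all of
whose quotients by open normal subgroups are (finite) `p`-groups. -/
structure IsProP (p : ℕ) (G : Type u) [Group G] [TopologicalSpace G] [IsTopologicalGroup G] :
    Prop where
  compact : CompactSpace G
  t2 : T2Space G
  totallyDisconnected : TotallyDisconnectedSpace G
  isPGroup : ∀ N : OpenNormalSubgroup G, IsPGroup p (G ⧸ N.toSubgroup)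

/-- The closed normal subgroup `⟨S⟩ᴺ` of a topological group (topologically) generated, as a normal
subgroup, by `S`. -/
def closedNormalClosure {G : Type u} [Group G] [TopologicalSpace G] [IsTopologicalGroup G]
    (S : Set G) : Subgroup G :=
  (Subgroup.normalClosure S).topologicalClosure

/-! ### The free pro-`p` group on `n` generators

It is the pro-`p` completion of the (abstract) free group on `n` letters, i.e. the inverse limit of
its quotients by the normal subgroups of index a power of `p`. -/

/-- The normal subgroups of `p`-power index of the free group on `n` letters. -/
def PIndexSubgroup (p n : ℕ) : Type :=
  {N : Subgroup (FreeGroup (Fin n)) // N.Normal ∧ ∃ k : ℕ, N.index = p ^ k}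

instance (p n : ℕ) (N : PIndexSubgroup p n) : N.1.Normal := N.2.1

/-- The finite `p`-group `FreeGroup (Fin n) ⧸ N`. -/
def FreeQuotient (p n : ℕ) (N : PIndexSubgroup p n) : Type := FreeGroup (Fin n) ⧸ N.1

instance (p n : ℕ) (N : PIndexSubgroup p n) : Group (FreeQuotient p n N) :=
  inferInstanceAs (Group (FreeGroup (Fin n) ⧸ N.1))

/-- The finite quotients carry the discrete topology. -/
instance (p n : ℕ) (N : PIndexSubgroup p n) : TopologicalSpace (FreeQuotient p n N) := ⊥

instance (p n : ℕ) (N : PIndexSubgroup p n) : DiscreteTopology (FreeQuotient p n N) := ⟨rfl⟩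

/-- The transition map `FreeGroup (Fin n) ⧸ N → FreeGroup (Fin n) ⧸ M` for `N ≤ M`. -/
def freeTransition (p n : ℕ) {N M : PIndexSubgroup p n} (h : N.1 ≤ M.1) :
    FreeQuotient p n N →* FreeQuotient p n M :=
  QuotientGroup.map N.1 M.1 (MonoidHom.id _) h

/-- The compatible families, as a subgroup of the product of all the finite quotients. -/
def freeProPSubgroup (p n : ℕ) : Subgroup (∀ N : PIndexSubgroup p n, FreeQuotient p n N) where
  carrier := {x | ∀ (N M : PIndexSubgroup p n) (h : N.1 ≤ M.1), freeTransition p n h (x N) = x M}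
  mul_mem' := by
    intro a b ha hb N M h
    simp only [Pi.mul_apply, map_mul, ha N M h, hb N M h]
  one_mem' := by
    intro N M h
    simp only [Pi.one_apply, map_one]
  inv_mem' := by
    intro a ha N M h
    simp only [Pi.inv_apply, map_inv, ha N M h]

/-- The free pro-`p` group on `n` generators (with the topology induced by the product topology). -/
abbrev FreeProP (p n : ℕ) : Type := freeProPSubgroup p n

/-- `G` is finitely presented as a pro-`p` group: it is a quotient of a free pro-`p` group of finite
rank by the closed normal subgroup generated by finitely many elements. -/
def IsFinitelyPresented (p : ℕ) (G : Type u) [Group G] [TopologicalSpace G] : Prop :=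
  ∃ (n : ℕ) (ψ : FreeProP p n →* G) (S : Set (FreeProP p n)),
    Continuous ψ ∧ Function.Surjective ψ ∧ S.Finite ∧ ψ.ker = closedNormalClosure S

/-! ### The completed group algebra `𝔽_p⟦G⟧` and the Zassenhaus filtration -/

section GroupAlgebra

variable (p : ℕ) (G : Type u) [Group G] [TopologicalSpace G]

/-- The transition map `𝔽_p[G ⧸ N] → 𝔽_p[G ⧸ M]` for `N ≤ M`. -/
noncomputable def algTransition {N M : OpenNormalSubgroup G} (h : N.toSubgroup ≤ M.toSubgroup) :
    MonoidAlgebra (ZMod p) (G ⧸ N.toSubgroup) →+* MonoidAlgebra (ZMod p) (G ⧸ M.toSubgroup) :=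
  MonoidAlgebra.mapDomainRingHom (ZMod p)
    (QuotientGroup.map N.toSubgroup M.toSubgroup (MonoidHom.id G) h)

/-- The compatible families, as a subring of the product of the group algebras `𝔽_p[G ⧸ N]`, `N`
running through the open normal subgroups of `G`. -/
noncomputable def completedGroupAlgebraSubring :
    Subring (∀ N : OpenNormalSubgroup G, MonoidAlgebra (ZMod p) (G ⧸ N.toSubgroup)) where
  carrier := {a | ∀ (N M : OpenNormalSubgroup G) (h : N.toSubgroup ≤ M.toSubgroup),
    algTransition p G h (a N) = a M}
  mul_mem' := by
    intro a b ha hb N M h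
    simp only [Pi.mul_apply, map_mul, ha N M h, hb N M h]
  one_mem' := by
    intro N M h
    simp only [Pi.one_apply, map_one]
  add_mem' := by
    intro a b ha hb N M h
    simp only [Pi.add_apply, map_add, ha N M h, hb N M h]
  zero_mem' := by
    intro N M h
    simp only [Pi.zero_apply, map_zero]
  neg_mem' := by
    intro a ha N M h
    simp only [Pi.neg_apply, map_neg, ha N M h]

/-- The completed group algebra `𝔽_p⟦G⟧ = lim 𝔽_p[G ⧸ N]`, `N` running through the open normal
subgroups of `G`. -/
def CompletedGroupAlgebra : Type u := completedGroupAlgebraSubring p G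

noncomputable instance : Ring (CompletedGroupAlgebra p G) :=
  inferInstanceAs (Ring (completedGroupAlgebraSubring p G))

/-- The projection `𝔽_p⟦G⟧ → 𝔽_p[G ⧸ N]`. -/
noncomputable def CompletedGroupAlgebra.proj (N : OpenNormalSubgroup G) :
    CompletedGroupAlgebra p G →+* MonoidAlgebra (ZMod p) (G ⧸ N.toSubgroup) :=
  (Pi.evalRingHom _ N).comp (completedGroupAlgebraSubring p G).subtype

/-- The whole group as an open normal subgroup. -/
def topOpenNormal : OpenNormalSubgroup G where
  toOpenSubgroup := ⊤
  isNormal' := inferInstanceAs (⊤ : Subgroup G).Normal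

/-- The augmentation `𝔽_p⟦G⟧ → 𝔽_p`: the projection to `𝔽_p[G ⧸ G]` followed by the sum of the
coefficients. -/
noncomputable def augmentation : CompletedGroupAlgebra p G →+* ZMod p :=
  (((MonoidAlgebra.lift (ZMod p) (ZMod p) (G ⧸ (topOpenNormal G).toSubgroup)) 1 :
      MonoidAlgebra (ZMod p) (G ⧸ (topOpenNormal G).toSubgroup) →ₐ[ZMod p] ZMod p) :
      MonoidAlgebra (ZMod p) (G ⧸ (topOpenNormal G).toSubgroup) →+* ZMod p).comp
    (CompletedGroupAlgebra.proj p G (topOpenNormal G))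

/-- The augmentation ideal `I_G` of `𝔽_p⟦G⟧`. -/
noncomputable def augmentationIdeal : Ideal (CompletedGroupAlgebra p G) :=
  RingHom.ker (augmentation p G)

variable {G}

/-- The image of `g : G` in `𝔽_p⟦G⟧`. -/
noncomputable def toCompletedGroupAlgebra (g : G) : CompletedGroupAlgebra p G :=
  ⟨fun N => MonoidAlgebra.of (ZMod p) (G ⧸ N.toSubgroup) (QuotientGroup.mk g), by
    intro N M h
    simp only [algTransition, MonoidAlgebra.of_apply, MonoidAlgebra.mapDomainRingHom_apply,
      MonoidAlgebra.mapDomain_single]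
    rfl⟩

/-- The depth `ω(g) = max {n | g - 1 ∈ Iⁿ}` of `g`, equal to `∞` if `g - 1 ∈ Iⁿ` for all `n`
(for instance if `g = 1`). -/
noncomputable def depth (g : G) : ℕ∞ :=
  ⨆ n ∈ {n : ℕ | toCompletedGroupAlgebra p g - 1 ∈ augmentationIdeal p G ^ n}, (n : ℕ∞)

end GroupAlgebra

/-! ### Generator and relation ranks -/

section Cohomology

variable (p : ℕ) (G : Type u) [Group G] [TopologicalSpace G] [IsTopologicalGroup G]

instance : ContinuousSMul (ZMod p) (ULift.{u} (ZMod p)) := ⟨continuous_of_discreteTopology⟩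

/-- The continuous cohomology group `Hⁱ(G, ℤ/p)`, with trivial action on `ℤ/p`. -/
noncomputable abbrev cohomologyModP (i : ℕ) : TopModuleCat.{u} (ZMod p) :=
  continuousCohomology i
    (TopRep.of (ContRepresentation.trivial (ZMod p) G (ULift.{u} (ZMod p))))

/-- `d(G) = dim H¹(G, ℤ/p)`. -/
noncomputable def generatorRank : ℕ := Module.finrank (ZMod p) (cohomologyModP p G 1)

/-- `r(G) = dim H²(G, ℤ/p)`. -/
noncomputable def relationRank : ℕ := Module.finrank (ZMod p) (cohomologyModP p G 2)

end Cohomology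

/-- The integer `λ` attached to `a > 1`: `a - 1` if `a` is an integer, and `⌊a⌋` otherwise. -/
noncomputable def cuttingBase (a : ℝ) : ℕ :=
  if (⌊a⌋₊ : ℝ) = a then ⌊a⌋₊ - 1 else ⌊a⌋₊

end ProP

namespace ProP

instance (p n : ℕ) [Fact p.Prime] (N : PIndexSubgroup p n) : Finite (FreeQuotient p n N) := by
  obtain ⟨k, hk⟩ := N.2.2
  have : N.1.FiniteIndex := ⟨by rw [hk]; exact pow_ne_zero _ (Fact.out : p.Prime).ne_zero⟩
  exact inferInstanceAs (Finite (FreeGroup (Fin n) ⧸ N.1))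

theorem isClosed_freeProPSubgroup (p n : ℕ) :
    IsClosed (freeProPSubgroup p n : Set (∀ N : PIndexSubgroup p n, FreeQuotient p n N)) := by
  have : (freeProPSubgroup p n : Set (∀ N : PIndexSubgroup p n, FreeQuotient p n N)) =
      ⋂ (N : PIndexSubgroup p n) (M : PIndexSubgroup p n) (h : N.1 ≤ M.1),
        {x : ∀ N : PIndexSubgroup p n, FreeQuotient p n N | freeTransition p n h (x N) = x M} := by
    ext x
    simp only [Set.mem_iInter]
    exact ⟨fun h => h, fun h => h⟩
  rw [this]
  refine isClosed_iInter fun N => isClosed_iInter fun M => isClosed_iInter fun h => ?_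
  exact isClosed_eq (continuous_of_discreteTopology.comp (continuous_apply N)) (continuous_apply M)

instance (p n : ℕ) [Fact p.Prime] : CompactSpace (FreeProP p n) :=
  isCompact_iff_compactSpace.1 (isClosed_freeProPSubgroup p n).isCompact

/-- The canonical map from the free group to the free pro-`p` group. -/
def freeProPOf (p n : ℕ) : FreeGroup (Fin n) →* FreeProP p n where
  toFun w := ⟨fun N => (QuotientGroup.mk w : FreeGroup (Fin n) ⧸ N.1), fun _ _ _ => rfl⟩
  map_one' := rfl
  map_mul' _ _ := rfl

/-- The topological generators of the free pro-`p` group. -/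
def freeProPGen (p n : ℕ) (j : Fin n) : FreeProP p n := freeProPOf p n (FreeGroup.of j)

theorem exists_pow_index_iff (p : ℕ) [Fact p.Prime] {H : Type*} [Group H] (N : Subgroup H)
    [N.Normal] : (∃ k, N.index = p ^ k) ↔ Finite (H ⧸ N) ∧ IsPGroup p (H ⧸ N) := by
  constructor
  · rintro ⟨k, hk⟩
    have : N.FiniteIndex := ⟨by rw [hk]; exact pow_ne_zero _ (Fact.out : p.Prime).ne_zero⟩
    exact ⟨inferInstance, IsPGroup.of_card (n := k) hk⟩
  · rintro ⟨_, h⟩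
    exact IsPGroup.iff_card.1 h

theorem exists_pow_index_inf (p : ℕ) [Fact p.Prime] {H : Type*} [Group H] {N M : Subgroup H}
    [N.Normal] [M.Normal] (hN : ∃ k, N.index = p ^ k) (hM : ∃ k, M.index = p ^ k) :
    ∃ k, (N ⊓ M).index = p ^ k := by
  rw [exists_pow_index_iff] at *
  obtain ⟨_, hN⟩ := hN
  obtain ⟨_, hM⟩ := hM
  let f : H ⧸ (N ⊓ M) →* (H ⧸ N) × (H ⧸ M) :=
    (QuotientGroup.map _ N (MonoidHom.id H) inf_le_left).prod
      (QuotientGroup.map _ M (MonoidHom.id H) inf_le_right)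
  have hf : Function.Injective f := by
    rw [injective_iff_map_eq_one]
    intro x hx
    induction x using QuotientGroup.induction_on with
    | H z =>
      have h1 := congrArg Prod.fst hx
      have h2 := congrArg Prod.snd hx
      rw [QuotientGroup.eq_one_iff]
      exact ⟨(QuotientGroup.eq_one_iff z).1 h1, (QuotientGroup.eq_one_iff z).1 h2⟩
  refine ⟨Finite.of_injective f hf, IsPGroup.of_injective ?_ f hf⟩
  obtain ⟨a, ha⟩ := IsPGroup.iff_card.1 hN
  obtain ⟨b, hb⟩ := IsPGroup.iff_card.1 hM
  exact IsPGroup.of_card (n := a + b) (by rw [Nat.card_prod, ha, hb, pow_add])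

theorem exists_pIndexSubgroup_le (p n : ℕ) [Fact p.Prime] (s : Finset (PIndexSubgroup p n)) :
    ∃ K : PIndexSubgroup p n, ∀ N ∈ s, K.1 ≤ N.1 := by
  classical
  induction s using Finset.induction_on with
  | empty => exact ⟨⟨⊤, inferInstance, 0, by simp⟩, by simp⟩
  | insert N s _ ih =>
    obtain ⟨K, hK⟩ := ih
    refine ⟨⟨N.1 ⊓ K.1, inferInstance, exists_pow_index_inf p N.2.2 K.2.2⟩, ?_⟩
    intro M hM
    rcases Finset.mem_insert.1 hM with rfl | hM
    · exact inf_le_left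
    · exact inf_le_right.trans (hK M hM)

theorem denseRange_freeProPOf (p n : ℕ) [Fact p.Prime] : DenseRange (freeProPOf p n) := by
  intro x
  rw [mem_closure_iff]
  intro U hU hx
  obtain ⟨V, hV, rfl⟩ := isOpen_induced_iff.1 hU
  obtain ⟨s, u, hu, hsub⟩ := isOpen_pi_iff.1 hV x.1 hx
  obtain ⟨K, hK⟩ := exists_pIndexSubgroup_le p n s
  obtain ⟨w, hw⟩ := QuotientGroup.mk_surjective (s := K.1) (x.1 K)
  refine ⟨freeProPOf p n w, hsub ?_, w, rfl⟩
  intro N hN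
  have h1 : (freeProPOf p n w).1 N = x.1 N := by
    rw [← x.2 K N (hK N hN), ← (freeProPOf p n w).2 K N (hK N hN)]
    exact congrArg (freeTransition p n (hK N hN)) hw
  rw [h1]
  exact (hu N hN).2

theorem monoidHom_ext_freeProPGen {p n : ℕ} [Fact p.Prime] {E : Type*} [Group E]
    [TopologicalSpace E] [T2Space E] {f g : FreeProP p n →* E} (hf : Continuous f)
    (hg : Continuous g) (h : ∀ j, f (freeProPGen p n j) = g (freeProPGen p n j)) : f = g := by
  have h1 : f.comp (freeProPOf p n) = g.comp (freeProPOf p n) := FreeGroup.ext_hom _ _ h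
  apply DFunLike.coe_injective
  exact (denseRange_freeProPOf p n).equalizer hf hg (funext fun w => DFunLike.congr_fun h1 w)

theorem exists_continuous_lift (p n : ℕ) [Fact p.Prime] {E : Type*} [Group E]
    [TopologicalSpace E] [Finite E] (hE : IsPGroup p E) (y : Fin n → E) :
    ∃ f : FreeProP p n →* E, Continuous f ∧ ∀ j, f (freeProPGen p n j) = y j := by
  let f₀ : FreeGroup (Fin n) →* E := FreeGroup.lift y
  have hK : ∃ k, f₀.ker.index = p ^ k := by
    rw [Subgroup.index_ker]
    exact IsPGroup.iff_card.1 (hE.to_subgroup f₀.range)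
  let K : PIndexSubgroup p n := ⟨f₀.ker, inferInstance, hK⟩
  let g : FreeQuotient p n K →* E := QuotientGroup.kerLift f₀
  let pr : FreeProP p n →* FreeQuotient p n K :=
    (Pi.evalMonoidHom _ K).comp (freeProPSubgroup p n).subtype
  refine ⟨g.comp pr, ?_, ?_⟩
  · exact (continuous_of_discreteTopology (f := g)).comp
      ((continuous_apply K).comp continuous_subtype_val)
  · intro j
    exact FreeGroup.lift_apply_of

end ProP

section

open CategoryTheory Limits

theorem TopModuleCat.exists_linearMap_homology {k : Type*} [Ring k] [TopologicalSpace k]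
    (S : ShortComplex (TopModuleCat k)) :
    ∃ π : S.g.hom.ker →ₗ[k] S.homology, Function.Surjective π ∧
      ∀ z, π z = 0 → ∃ y, S.f.hom y = z.1 := by
  let D : S.LeftHomologyData :=
    ⟨_, _, _, _, _, TopModuleCat.isLimitKer _, by simp, TopModuleCat.isColimitCoker _⟩
  let e : D.H ≅ S.homology := D.homologyIso.symm
  have hinj : Function.Injective e.hom.hom := by
    intro x y h
    have := congrArg e.inv.hom h
    simpa using this
  have hsurj : Function.Surjective e.hom.hom := fun x => ⟨e.inv.hom x, by simp⟩
  refine ⟨e.hom.hom.toLinearMap ∘ₗ D.π.hom.toLinearMap, ?_, ?_⟩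
  · exact hsurj.comp (TopModuleCat.cokerπ_surjective _)
  · intro z hz
    have h1 : D.π.hom z = 0 := hinj (by rw [map_zero]; exact hz)
    obtain ⟨y, hy⟩ := (Submodule.Quotient.mk_eq_zero _).mp h1
    refine ⟨y, ?_⟩
    rw [← hy]
    rfl

theorem TopModuleCat.exists_linearMap_homology_succ {k : Type*} [Ring k] [TopologicalSpace k]
    (K : CochainComplex (TopModuleCat k) ℕ) (i : ℕ) :
    ∃ π : (K.d (i + 1) (i + 2)).hom.ker →ₗ[k] K.homology (i + 1), Function.Surjective π ∧
      ∀ z, π z = 0 → ∃ y, (K.d i (i + 1)).hom y = z.1 := by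
  obtain ⟨π, hs, hk⟩ := exists_linearMap_homology (K.sc' i (i + 1) (i + 2))
  let e : (K.sc' i (i + 1) (i + 2)).homology ≅ K.homology (i + 1) :=
    ShortComplex.homologyMapIso (K.isoSc' i (i + 1) (i + 2) (by simp) (by simp)).symm
  have hinj : Function.Injective e.hom.hom := by
    intro x y h
    have := congrArg e.inv.hom h
    simpa using this
  have hsurj : Function.Surjective e.hom.hom := fun x => ⟨e.inv.hom x, by simp⟩
  refine ⟨e.hom.hom.toLinearMap ∘ₗ π, hsurj.comp hs, fun z hz => hk z (hinj ?_)⟩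
  rw [map_zero]; exact hz

namespace ProP
variable (p : ℕ) (G : Type u) [Group G] [TopologicalSpace G] [IsTopologicalGroup G]

/-- The coefficient module `ℤ/p` with trivial action. -/
noncomputable abbrev coeffModP : TopRep.{u} (ZMod p) G :=
  TopRep.of (ContRepresentation.trivial (ZMod p) G (ULift.{u} (ZMod p)))

variable {p G}

theorem resolution_d_two_apply (σ : C(G, C(G, ULift.{u} (ZMod p)))) (g₀ g₁ g₂ : G) :
    ((TopRep.d (coeffModP p G) 2).hom σ : C(G, C(G, C(G, ULift.{u} (ZMod p))))) g₀ g₁ g₂ =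
      σ g₁ g₂ - (σ g₀ g₂ - σ g₀ g₁) := rfl

theorem resolution_d_three_apply (σ : C(G, C(G, C(G, ULift.{u} (ZMod p))))) (g₀ g₁ g₂ g₃ : G) :
    ((TopRep.d (coeffModP p G) 3).hom σ : C(G, C(G, C(G, C(G, ULift.{u} (ZMod p)))))) g₀ g₁ g₂ g₃ =
      σ g₁ g₂ g₃ - (σ g₀ g₂ g₃ - (σ g₀ g₁ g₃ - σ g₀ g₁ g₂)) := rfl

theorem homogeneousCochains_d_apply_coe (i : ℕ)
    (σ : (TopRep.homogeneousCochains (coeffModP p G)).X i) :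
    (((TopRep.homogeneousCochains (coeffModP p G)).d i (i + 1)).hom σ).1 =
      (TopRep.d (coeffModP p G) (i + 1)).hom σ.1 :=
  TopRep.homogeneousCochains.d_apply _ i σ

theorem invariant_two (σ : (TopRep.homogeneousCochains (coeffModP p G)).X 1) (g x y : G) :
    (σ.1 : C(G, C(G, ULift.{u} (ZMod p)))) (g * x) (g * y) =
    (σ.1 : C(G, C(G, ULift.{u} (ZMod p)))) x y := by
  have h := σ.2 g
  have := DFunLike.congr_fun (DFunLike.congr_fun h (g * x)) (g * y)
  rw [← this]
  change (σ.1 : C(G, C(G, ULift.{u} (ZMod p)))) (g⁻¹ * (g * x)) (g⁻¹ * (g * y)) = _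
  simp


variable [Fact p.Prime]

theorem exists_continuous_additive_of_generatorRank {d : ℕ} (hd : d = generatorRank p G)
    (x : Fin d → G)
    (hx : ∀ ψ : G → ZMod p, Continuous ψ → (∀ g h, ψ (g * h) = ψ g + ψ h) →
      (∀ j, ψ (x j) = 0) → ∀ g, ψ g = 0) (v : Fin d → ZMod p) :
    ∃ ψ : G → ZMod p, Continuous ψ ∧ (∀ g h, ψ (g * h) = ψ g + ψ h) ∧ ∀ j, ψ (x j) = v j := by
  obtain ⟨π, hπ, -⟩ := TopModuleCat.exists_linearMap_homology_succ
    (TopRep.homogeneousCochains (coeffModP p G)) 0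
  let Z := ((TopRep.homogeneousCochains (coeffModP p G)).d 1 2).hom.ker
  let val : Z → C(G, C(G, ULift.{u} (ZMod p))) := fun σ => σ.1.1
  have hcoc : ∀ (σ : Z) (a b c : G), val σ b c - (val σ a c - val σ a b) = 0 := by
    intro σ a b c
    rw [← resolution_d_two_apply]
    have h1 : (((TopRep.homogeneousCochains (coeffModP p G)).d 1 2).hom σ.1).1 = 0 := by
      rw [show ((TopRep.homogeneousCochains (coeffModP p G)).d 1 2).hom σ.1 = 0 from σ.2]; rfl
    rw [homogeneousCochains_d_apply_coe] at h1
    exact DFunLike.congr_fun (DFunLike.congr_fun (DFunLike.congr_fun h1 a) b) c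
  have hinv : ∀ (σ : Z) (a b c : G), val σ (a * b) (a * c) = val σ b c := fun σ a b c =>
    invariant_two σ.1 a b c
  let ψ : Z → G → ZMod p := fun σ g => (val σ 1 g).down
  have hψc : ∀ σ, Continuous (ψ σ) := fun σ => continuous_uliftDown.comp (val σ 1).continuous
  have hψadd : ∀ σ g h, ψ σ (g * h) = ψ σ g + ψ σ h := by
    intro σ g h
    have h1 := hcoc σ 1 g (g * h)
    have h2 := hinv σ g 1 h
    rw [mul_one] at h2
    rw [h2] at h1
    have := congrArg ULift.down h1
    change ψ σ h - (ψ σ (g * h) - ψ σ g) = 0 at this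
    linear_combination -this
  let ev : Z →ₗ[ZMod p] (Fin d → ZMod p) :=
    { toFun := fun σ j => ψ σ (x j)
      map_add' := fun _ _ => rfl
      map_smul' := fun _ _ => rfl }
  have hev : Function.Injective ev := by
    rw [injective_iff_map_eq_zero]
    intro σ hσ
    have h0 := hx (ψ σ) (hψc σ) (hψadd σ) (fun j => congrFun hσ j)
    apply Subtype.ext
    apply Subtype.ext
    ext a b
    have h2 := hinv σ a 1 (a⁻¹ * b)
    rw [mul_one, mul_inv_cancel_left] at h2
    have h3 : val σ a b = 0 := by
      rw [h2]
      exact ULift.ext _ _ (h0 _)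
    exact congrArg ULift.down h3
  have : FiniteDimensional (ZMod p) Z := FiniteDimensional.of_injective ev hev
  have h1 : d ≤ Module.finrank (ZMod p) Z := by
    rw [hd]
    exact LinearMap.finrank_le_finrank_of_surjective hπ
  have h2 : Module.finrank (ZMod p) Z ≤ d := by
    simpa using LinearMap.finrank_le_finrank_of_injective hev
  have hsurj : Function.Surjective ev :=
    (LinearMap.injective_iff_surjective_of_finrank_eq_finrank (by simpa using h2.antisymm h1)).1 hev
  obtain ⟨σ, hσ⟩ := hsurj v
  exact ⟨ψ σ, hψc σ, hψadd σ, fun j => congrFun hσ j⟩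

theorem finrank_le_relationRank {V : Type*} [AddCommGroup V] [Module (ZMod p) V]
    (z : V →ₗ[ZMod p] C(G × G, ZMod p))
    (hz : ∀ v a b c, z v (b, c) - z v (a * b, c) + z v (a, b * c) - z v (a, b) = 0)
    (hinj : ∀ v (β : G → ZMod p), Continuous β →
      (∀ g h, z v (g, h) = β g + β h - β (g * h)) → v = 0)
    (hr : relationRank p G ≠ 0) : Module.finrank (ZMod p) V ≤ relationRank p G := by
  obtain ⟨π, -, hπ⟩ := TopModuleCat.exists_linearMap_homology_succ
    (TopRep.homogeneousCochains (coeffModP p G)) 1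
  let Z := ((TopRep.homogeneousCochains (coeffModP p G)).d 2 3).hom.ker
  let σ : V → C((G × G) × G, ULift.{u} (ZMod p)) := fun v =>
    ⟨fun q => ULift.up (z v (q.1.1⁻¹ * q.1.2, q.1.2⁻¹ * q.2)),
      continuous_uliftUp.comp ((z v).continuous.comp (by fun_prop))⟩
  let τ : V → (TopRep.homogeneousCochains (coeffModP p G)).X 2 := fun v =>
    ⟨(σ v).curry.curry, by
      intro g
      refine ContinuousMap.ext fun a => ContinuousMap.ext fun b => ContinuousMap.ext fun c => ?_
      change ULift.up (z v ((g⁻¹ * a)⁻¹ * (g⁻¹ * b), (g⁻¹ * b)⁻¹ * (g⁻¹ * c))) =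
        ULift.up (z v (a⁻¹ * b, b⁻¹ * c))
      congr 3 <;> group⟩
  have hτ : ∀ v, τ v ∈ Z := by
    intro v
    change ((TopRep.homogeneousCochains (coeffModP p G)).d 2 3).hom (τ v) = 0
    apply Subtype.ext
    rw [homogeneousCochains_d_apply_coe]
    refine ContinuousMap.ext fun a => ContinuousMap.ext fun b => ContinuousMap.ext fun c =>
      ContinuousMap.ext fun e => ?_
    refine (resolution_d_three_apply (σ v).curry.curry a b c e).trans ?_
    apply ULift.ext
    change z v (b⁻¹ * c, c⁻¹ * e) - (z v (a⁻¹ * c, c⁻¹ * e) -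
      (z v (a⁻¹ * b, b⁻¹ * e) - z v (a⁻¹ * b, b⁻¹ * c))) = 0
    have h := hz v (a⁻¹ * b) (b⁻¹ * c) (c⁻¹ * e)
    rw [show a⁻¹ * b * (b⁻¹ * c) = a⁻¹ * c by group,
      show b⁻¹ * c * (c⁻¹ * e) = b⁻¹ * e by group] at h
    linear_combination h
  let T : V →ₗ[ZMod p] Z :=
    { toFun := fun v => ⟨τ v, hτ v⟩
      map_add' := fun v w => by
        apply Subtype.ext; apply Subtype.ext
        refine ContinuousMap.ext fun a => ContinuousMap.ext fun b => ContinuousMap.ext fun c => ?_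
        change ULift.up (z (v + w) _) = ULift.up (z v _) + ULift.up (z w _)
        rw [map_add]; rfl
      map_smul' := fun s v => by
        apply Subtype.ext; apply Subtype.ext
        refine ContinuousMap.ext fun a => ContinuousMap.ext fun b => ContinuousMap.ext fun c => ?_
        change ULift.up (z (s • v) _) = s • ULift.up (z v _)
        rw [map_smul]; rfl }
  have hT : Function.Injective (π ∘ₗ T) := by
    rw [injective_iff_map_eq_zero]
    intro v hv
    obtain ⟨y, hy⟩ := hπ (T v) hv
    let b : C(G, C(G, ULift.{u} (ZMod p))) := y.1
    have hb : ∀ g h, z v (g, h) = (b g (g * h)).down - ((b 1 (g * h)).down - (b 1 g).down) := by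
      intro g h
      have h1 : (((TopRep.homogeneousCochains (coeffModP p G)).d 1 2).hom y).1 =
          (σ v).curry.curry := congrArg Subtype.val hy
      rw [homogeneousCochains_d_apply_coe] at h1
      have h2 := DFunLike.congr_fun (DFunLike.congr_fun (DFunLike.congr_fun h1 (1 : G)) g) (g * h)
      have h3 := (resolution_d_two_apply b 1 g (g * h)).symm.trans h2
      have h4 := congrArg ULift.down h3
      change (b g (g * h)).down - ((b 1 (g * h)).down - (b 1 g).down) =
        z v (1⁻¹ * g, g⁻¹ * (g * h)) at h4
      rw [h4]; congr 2 <;> group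
    refine hinj v (fun g => (b 1 g).down) (continuous_uliftDown.comp (b 1).continuous) ?_
    intro g h
    have h2 := invariant_two y g 1 h
    rw [mul_one] at h2
    rw [hb, show b g (g * h) = b 1 h from h2]
    ring
  have : FiniteDimensional (ZMod p) (cohomologyModP p G 2) :=
    Module.finite_of_finrank_pos (Nat.pos_of_ne_zero hr)
  exact LinearMap.finrank_le_finrank_of_injective hT

end ProP

end

namespace ProP

theorem map_mem_pow_of_forall_mem {A B : Type*} [Ring A] [Ring B] (f : A →+* B) {I : Ideal A}
    {J : Ideal B} (h : ∀ x ∈ I, f x ∈ J) (n : ℕ) : ∀ x ∈ I ^ n, f x ∈ J ^ n := by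
  induction n with
  | zero => intro x _; rw [Submodule.pow_zero, Ideal.one_eq_top]; trivial
  | succ n ih =>
    intro x hx
    rw [Submodule.pow_succ] at hx ⊢
    induction hx using Submodule.mul_induction_on' with
    | mem_mul_mem a ha b hb => rw [map_mul]; exact Ideal.mul_mem_mul (ih a ha) (h b hb)
    | add a _ b _ ha hb => rw [map_add]; exact add_mem ha hb

theorem pow_smul_pow_smul {A : Type*} [Ring A] {W : Type*} [AddCommGroup W] [Module A W]
    (I : Ideal A) [I.IsTwoSided] (m n : ℕ) (N : Submodule A W) :
    I ^ m • I ^ n • N = I ^ (m + n) • N := by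
  rw [Ideal.IsTwoSided.pow_add]
  exact (Submodule.smul_assoc _ _ _).symm

section GroupRing

variable (k P : Type*) [CommRing k] [Group P]

/-- The augmentation of a group algebra. -/
noncomputable def groupAug : MonoidAlgebra k P →ₐ[k] k := MonoidAlgebra.lift k k P 1

/-- The augmentation ideal of a group algebra. -/
noncomputable def augI : Ideal (MonoidAlgebra k P) := RingHom.ker (groupAug k P).toRingHom

instance : (augI k P).IsTwoSided := inferInstanceAs (RingHom.ker _).IsTwoSided

variable {k P}

@[simp] theorem groupAug_of (g : P) : groupAug k P (MonoidAlgebra.of k P g) = 1 := by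
  simp [groupAug]

theorem mem_augI {u : MonoidAlgebra k P} : u ∈ augI k P ↔ groupAug k P u = 0 := Iff.rfl

theorem of_sub_one_mem_augI (g : P) : MonoidAlgebra.of k P g - 1 ∈ augI k P := by
  rw [mem_augI, map_sub, groupAug_of, map_one, sub_self]

theorem groupAug_mapDomain {E : Type*} [Group E] (π : E →* P) (u : MonoidAlgebra k E) :
    groupAug k P (MonoidAlgebra.mapDomainRingHom k π u) = groupAug k E u := by
  induction u using MonoidAlgebra.induction_linear with
  | zero => simp
  | add x y hx hy => rw [map_add, map_add, map_add, hx, hy]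
  | single g c =>
    simp [groupAug]

theorem mapDomain_mem_augI_pow {E : Type*} [Group E] (π : E →* P) (n : ℕ) :
    ∀ u ∈ augI k E ^ n, MonoidAlgebra.mapDomainRingHom k π u ∈ augI k P ^ n :=
  map_mem_pow_of_forall_mem _ (fun u hu => by
    rw [mem_augI, groupAug_mapDomain]; exact hu) n

variable {W : Type*} [AddCommGroup W] [Module k W] [Module (MonoidAlgebra k P) W]
  [IsScalarTower k (MonoidAlgebra k P) W]

variable (k) in
/-- `D` is a crossed homomorphism with respect to the action of `E` on `W` through `π`. -/
def IsCrossed {E : Type*} [Group E] (π : E →* P) (D : E → W) : Prop :=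
  ∀ x y, D (x * y) = D x + MonoidAlgebra.of k P (π x) • D y

section Crossed

variable {E : Type*} [Group E] {π : E →* P} {D : E → W}

omit [Module k W] [IsScalarTower k (MonoidAlgebra k P) W] in
theorem IsCrossed.map_one (hD : IsCrossed k π D) : D 1 = 0 := by
  have := hD 1 1
  rw [_root_.map_one, _root_.map_one, one_smul, mul_one] at this
  exact left_eq_add.1 this

omit [Module k W] [IsScalarTower k (MonoidAlgebra k P) W] in
theorem IsCrossed.map_inv (hD : IsCrossed k π D) (x : E) :
    MonoidAlgebra.of k P (π x) • D x⁻¹ = - D x := by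
  have := hD x x⁻¹
  rw [mul_inv_cancel, hD.map_one] at this
  exact (neg_eq_of_add_eq_zero_right this.symm).symm

omit [Module k W] [IsScalarTower k (MonoidAlgebra k P) W] in
theorem IsCrossed.map_mul_of_eq_one (hD : IsCrossed k π D) {x : E} (hx : π x = 1) (y : E) :
    D (x * y) = D x + D y := by
  rw [hD, hx, _root_.map_one, one_smul]

omit [Module k W] [IsScalarTower k (MonoidAlgebra k P) W] in
theorem IsCrossed.map_conj (hD : IsCrossed k π D) (x : E) {y : E} (hy : π y = 1) :
    D (x * y * x⁻¹) = MonoidAlgebra.of k P (π x) • D y := by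
  rw [hD, hD, _root_.map_mul, hy, mul_one, hD.map_inv]
  abel

variable (k D) in
/-- The linear extension to the group algebra of a function on a group. -/
noncomputable def linExt : MonoidAlgebra k E →ₗ[k] W :=
  (Finsupp.linearCombination k D).comp (MonoidAlgebra.coeffLinearEquiv k).toLinearMap

omit [Group E] in
@[simp] theorem linExt_single (g : E) (c : k) : linExt k D (MonoidAlgebra.single g c) = c • D g := by
  simp [linExt]

@[simp] theorem linExt_of (g : E) : linExt k D (MonoidAlgebra.of k E g) = D g := by
  simp [MonoidAlgebra.of_apply]

theorem linExt_mul (hD : IsCrossed k π D) (u v : MonoidAlgebra k E) :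
    linExt k D (u * v) =
      MonoidAlgebra.mapDomainRingHom k π u • linExt k D v + groupAug k E v • linExt k D u := by
  induction u using MonoidAlgebra.induction_on with
  | of g =>
    induction v using MonoidAlgebra.induction_on with
    | of h =>
      rw [← _root_.map_mul, linExt_of, linExt_of, linExt_of, hD, groupAug_of, one_smul, add_comm]
      simp
    | add x y hx hy =>
      rw [mul_add, map_add, map_add, map_add, hx, hy, smul_add, add_smul]
      abel
    | smul r x hx =>
      rw [mul_smul_comm, map_smul, map_smul, map_smul, hx, smul_add, smul_comm r, smul_assoc]
  | add x y hx hy =>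
    rw [add_mul, map_add, map_add, map_add, hx, hy, smul_add, add_smul]
    abel
  | smul r x hx =>
    rw [smul_mul_assoc, (linExt k D).map_smul, (linExt k D).map_smul, hx, smul_add,
      smul_comm r (groupAug k E v), ← smul_assoc, MonoidAlgebra.mapDomainRingHom_apply,
      MonoidAlgebra.mapDomainRingHom_apply, MonoidAlgebra.mapDomain_smul]

theorem linExt_mem_pow_smul_top (hD : IsCrossed k π D) (e : ℕ) :
    ∀ v ∈ augI k E ^ (e + 1), linExt k D v ∈ (augI k P ^ e • ⊤ : Submodule (MonoidAlgebra k P) W) := by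
  intro v hv
  rw [Submodule.pow_succ] at hv
  induction hv using Submodule.mul_induction_on' with
  | mem_mul_mem a ha b hb =>
    rw [linExt_mul hD, mem_augI.1 hb, zero_smul, add_zero]
    exact Submodule.smul_mem_smul (mapDomain_mem_augI_pow π e a ha) trivial
  | add a _ b _ ha hb => rw [map_add]; exact add_mem ha hb

end Crossed

end GroupRing
section Dimension

variable {k A W : Type*} [Field k] [Ring A] [Algebra k A] [AddCommGroup W] [Module k W] [Module A W]
  [IsScalarTower k A W]

theorem finrank_span_range_le [Module.Finite k A] [Module.Finite k W] {ι : Type*} [Fintype ι]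
    (c : ι → W) (J : ι → Ideal A) (h : ∀ i, ∀ u ∈ J i, u • c i = 0) :
    Module.finrank k (Submodule.span A (Set.range c)) ≤ ∑ i, Module.finrank k (A ⧸ J i) := by
  classical
  let T : (∀ i, A ⧸ J i) →ₗ[A] W := ∑ i, (Submodule.liftQ (J i) (LinearMap.toSpanSingleton A W (c i))
    (fun u hu => h i u hu)).comp (LinearMap.proj i)
  have hT : Submodule.span A (Set.range c) ≤ LinearMap.range T := by
    rw [Submodule.span_le]
    rintro _ ⟨i, rfl⟩
    refine ⟨Pi.single i (Submodule.Quotient.mk 1), ?_⟩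
    simp only [T, LinearMap.sum_apply, LinearMap.comp_apply, LinearMap.proj_apply]
    rw [Finset.sum_eq_single i]
    · rw [Pi.single_eq_same]
      exact one_smul A (c i)
    · intro j _ hj
      rw [Pi.single_eq_of_ne hj, map_zero]
    · simp
  calc Module.finrank k (Submodule.span A (Set.range c))
      ≤ Module.finrank k (LinearMap.range T) :=
        Submodule.finrank_mono (s := (Submodule.span A (Set.range c)).restrictScalars k)
          (t := (LinearMap.range T).restrictScalars k) hT
    _ ≤ Module.finrank k (∀ i, A ⧸ J i) :=
        LinearMap.finrank_range_le (T.restrictScalars k)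
    _ = _ := Module.finrank_pi_fintype k

theorem exists_span_range_eq_top_of_nilpotent [Module.Finite k W] (I : Ideal A) [I.IsTwoSided]
    (N : ℕ) (hN : (I ^ N • ⊤ : Submodule A W) = ⊥) :
    ∃ c : Fin (Module.finrank k (W ⧸ (I • ⊤ : Submodule A W))) → W,
      Submodule.span A (Set.range c) = ⊤ := by
  let b := Module.finBasis k (W ⧸ (I • ⊤ : Submodule A W))
  choose c hc using fun i => Submodule.Quotient.mk_surjective _ (b i)
  refine ⟨c, ?_⟩
  set S := Submodule.span A (Set.range c)
  have h1 : S ⊔ I • ⊤ = ⊤ := by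
    rw [eq_top_iff]
    intro w _
    have hw : (Submodule.Quotient.mk w : W ⧸ (I • ⊤ : Submodule A W)) =
        Submodule.Quotient.mk (∑ i, b.repr (Submodule.Quotient.mk w) i • c i) := by
      conv_lhs => rw [← b.sum_repr (Submodule.Quotient.mk w)]
      have : ∀ z : W, (Submodule.Quotient.mk z : W ⧸ (I • ⊤ : Submodule A W)) =
        ((I • ⊤ : Submodule A W).mkQ.restrictScalars k) z := fun _ => rfl
      rw [this (∑ i, _), map_sum]
      refine Finset.sum_congr rfl fun i _ => ?_
      rw [map_smul, ← hc i]; rfl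
    rw [Submodule.Quotient.eq] at hw
    rw [← add_sub_cancel (∑ i, b.repr (Submodule.Quotient.mk w) i • c i) w]
    refine Submodule.add_mem_sup ?_ hw
    refine sum_mem fun i _ => ?_
    rw [← smul_one_smul A]
    exact S.smul_mem _ (Submodule.subset_span ⟨i, rfl⟩)
  have h2 : ∀ j, S ⊔ I ^ j • ⊤ = ⊤ := by
    intro j
    induction j with
    | zero =>
      rw [Submodule.pow_zero, Ideal.one_eq_top, Submodule.top_smul, sup_top_eq]
    | succ j ih =>
      rw [eq_top_iff]
      refine ih.ge.trans (sup_le le_sup_left ?_)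
      conv_lhs => rw [← h1, Submodule.smul_sup]
      refine sup_le (Submodule.smul_le_right.trans le_sup_left) ?_
      have h3 := pow_smul_pow_smul I j 1 (⊤ : Submodule A W)
      rw [Submodule.pow_one] at h3
      rw [h3]
      exact le_sup_right
  have := h2 N
  rwa [hN, sup_bot_eq] at this

end Dimension

section Augmentation

variable {k P W : Type*} [Field k] [Group P] [AddCommGroup W] [Module k W]
  [Module (MonoidAlgebra k P) W] [IsScalarTower k (MonoidAlgebra k P) W]

theorem finrank_add_one_le_of_crossed [Finite P] [Module.Finite k W] {D : P → W}
    (hD : IsCrossed k (MonoidHom.id P) D)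
    (hspan : Submodule.span (MonoidAlgebra k P) (Set.range D) = ⊤) (N : ℕ)
    (hN : (augI k P ^ N • ⊤ : Submodule (MonoidAlgebra k P) W) = ⊥) :
    Module.finrank k W + 1 ≤ Module.finrank k (MonoidAlgebra k P ⧸ augI k P ^ (N + 1)) := by
  have hid : MonoidAlgebra.mapDomainRingHom k (MonoidHom.id P) = RingHom.id _ := by
    ext x <;> simp
  have hmul : ∀ u v, v ∈ augI k P → linExt k D (u * v) = u • linExt k D v := by
    intro u v hv
    rw [linExt_mul hD, mem_augI.1 hv, zero_smul, add_zero, hid, RingHom.id_apply]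
  let T : augI k P →ₗ[MonoidAlgebra k P] W :=
    { toFun := fun u => linExt k D u.1
      map_add' := fun u v => (linExt k D).map_add _ _
      map_smul' := fun a u => hmul a u.1 u.2 }
  have hT : LinearMap.range T = ⊤ := by
    rw [eq_top_iff, ← hspan, Submodule.span_le]
    rintro _ ⟨g, rfl⟩
    refine ⟨⟨_, of_sub_one_mem_augI g⟩, ?_⟩
    change linExt k D (MonoidAlgebra.of k P g - 1) = D g
    rw [map_sub, linExt_of, ← (MonoidAlgebra.of k P).map_one, linExt_of, hD.map_one, sub_zero]
  have h1 : linExt k D 1 = 0 := by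
    rw [← (MonoidAlgebra.of k P).map_one, linExt_of, hD.map_one]
  let Φ : MonoidAlgebra k P →ₗ[k] W × k := (linExt k D).prod (groupAug k P).toLinearMap
  have hΦ : Function.Surjective Φ := by
    rintro ⟨w, c⟩
    obtain ⟨u, hu⟩ := LinearMap.range_eq_top.1 hT w
    refine ⟨u.1 + c • 1, Prod.ext ?_ ?_⟩
    · change linExt k D (u.1 + c • 1) = w
      rw [map_add, map_smul, h1, smul_zero, add_zero]
      exact hu
    · change groupAug k P (u.1 + c • 1) = c
      rw [map_add, map_smul, map_one, mem_augI.1 u.2, zero_add, smul_eq_mul, mul_one]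
  have hker : (augI k P ^ (N + 1)).restrictScalars k ≤ LinearMap.ker Φ := by
    intro u hu
    have hu' : u ∈ augI k P ^ (N + 1) := hu
    have h2 := linExt_mem_pow_smul_top hD N u hu'
    rw [hN, Submodule.mem_bot] at h2
    have h3 : u ∈ augI k P := by
      rw [Submodule.pow_succ] at hu'
      exact Ideal.mul_le_right hu'
    exact Prod.ext h2 h3
  have := LinearMap.finrank_le_finrank_of_surjective (f := Submodule.liftQ _ Φ hker)
    (by
      intro y
      obtain ⟨x, hx⟩ := hΦ y
      exact ⟨Submodule.Quotient.mk x, hx⟩)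
  rw [(Submodule.Quotient.restrictScalarsEquiv k (augI k P ^ (N + 1))).finrank_eq,
    Module.finrank_prod, Module.finrank_self] at this
  exact this

end Augmentation
section Depth

variable {p : ℕ} {F : Type*} [Group F] [TopologicalSpace F]

theorem mem_pow_of_le_depth {x : F} {e : ℕ} (he : (e : ℕ∞) ≤ depth p x) :
    toCompletedGroupAlgebra p x - 1 ∈ augmentationIdeal p F ^ e := by
  cases e with
  | zero => rw [Submodule.pow_zero, Ideal.one_eq_top]; trivial
  | succ e =>
    have h1 : (e : ℕ∞) < depth p x := lt_of_lt_of_le (by exact_mod_cast Nat.lt_succ_self e) he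
    rw [depth] at h1
    simp only [lt_iSup_iff] at h1
    obtain ⟨n, hn, hen⟩ := h1
    exact Ideal.pow_le_pow_right (by exact_mod_cast hen) hn

theorem groupAug_proj (U : OpenNormalSubgroup F) (a : CompletedGroupAlgebra p F) :
    groupAug (ZMod p) _ (CompletedGroupAlgebra.proj p F U a) = augmentation p F a := by
  have h : U.toSubgroup ≤ (topOpenNormal F).toSubgroup := le_top
  have h2 : algTransition p F h (CompletedGroupAlgebra.proj p F U a) =
      CompletedGroupAlgebra.proj p F (topOpenNormal F) a := a.2 _ _ h
  rw [← groupAug_mapDomain (QuotientGroup.map U.toSubgroup (topOpenNormal F).toSubgroup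
    (MonoidHom.id F) h)]
  exact congrArg (groupAug (ZMod p) _) h2

theorem of_sub_one_mem_of_le_depth {E : Type*} [Group E] [TopologicalSpace E]
    [DiscreteTopology E] {h : F →* E} (hc : Continuous h) {x : F} {e : ℕ}
    (he : (e : ℕ∞) ≤ depth p x) :
    MonoidAlgebra.of (ZMod p) E (h x) - 1 ∈ augI (ZMod p) E ^ e := by
  let U : OpenNormalSubgroup F :=
    { toSubgroup := h.ker
      isOpen' := (isOpen_discrete {1}).preimage hc
      isNormal' := inferInstance }
  let g : CompletedGroupAlgebra p F →+* MonoidAlgebra (ZMod p) E :=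
    (MonoidAlgebra.mapDomainRingHom (ZMod p) (QuotientGroup.kerLift h)).comp
      (CompletedGroupAlgebra.proj p F U)
  have h1 := map_mem_pow_of_forall_mem g (I := augmentationIdeal p F) (J := augI (ZMod p) E)
    (fun a ha => by
      rw [mem_augI]
      refine (groupAug_mapDomain _ _).trans ?_
      exact (groupAug_proj U a).trans ha) e _ (mem_pow_of_le_depth he)
  rw [map_sub, map_one] at h1
  convert h1 using 2
  change _ = MonoidAlgebra.mapDomainRingHom (ZMod p) (QuotientGroup.kerLift h)
    (MonoidAlgebra.of (ZMod p) _ (QuotientGroup.mk x))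
  simp

end Depth

section Semidirect

variable {p : ℕ} [Fact p.Prime] {P W : Type u} [Group P] [AddCommGroup W] [Module (ZMod p) W]
  [Module (MonoidAlgebra (ZMod p) P) W]

variable (p P W) in
/-- The action of `P` on a module over its group algebra, as automorphisms of the multiplicative
version of its additive group. -/
noncomputable def groupRingAct : P →* MulAut (Multiplicative W) where
  toFun g :=
    { toFun := fun w => .ofAdd (MonoidAlgebra.of (ZMod p) P g • w.toAdd)
      invFun := fun w => .ofAdd (MonoidAlgebra.of (ZMod p) P g⁻¹ • w.toAdd)
      left_inv := fun w => by
        change Multiplicative.ofAdd (MonoidAlgebra.of (ZMod p) P g⁻¹ •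
          MonoidAlgebra.of (ZMod p) P g • w.toAdd) = w
        rw [← mul_smul, ← map_mul, inv_mul_cancel, map_one, one_smul]; rfl
      right_inv := fun w => by
        change Multiplicative.ofAdd (MonoidAlgebra.of (ZMod p) P g •
          MonoidAlgebra.of (ZMod p) P g⁻¹ • w.toAdd) = w
        rw [← mul_smul, ← map_mul, mul_inv_cancel, map_one, one_smul]; rfl
      map_mul' := fun v w => by
        change Multiplicative.ofAdd (MonoidAlgebra.of (ZMod p) P g • (v.toAdd + w.toAdd)) = _
        rw [smul_add]; rfl }
  map_one' := by
    ext w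
    change MonoidAlgebra.of (ZMod p) P 1 • w.toAdd = w.toAdd
    rw [map_one, one_smul]
  map_mul' g h := by
    ext w
    change MonoidAlgebra.of (ZMod p) P (g * h) • w.toAdd = MonoidAlgebra.of (ZMod p) P g •
      MonoidAlgebra.of (ZMod p) P h • w.toAdd
    rw [map_mul, mul_smul]

omit [Module (ZMod p) W] in
/-- Crossed homomorphisms from a free pro-`p` group exist with arbitrary values on the generators,
and factor through a finite group. -/
theorem exists_isCrossed [Finite P] [Finite W] [Module (ZMod p) W] (hP : IsPGroup p P)
    [TopologicalSpace P] [DiscreteTopology P] {d : ℕ} {π : FreeProP p d →* P} (hπ : Continuous π)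
    (y : Fin d → W) :
    ∃ (E : Type u) (_ : Group E) (_ : TopologicalSpace E) (_ : DiscreteTopology E)
      (h : FreeProP p d →* E) (q : E →* P) (D : E → W), Continuous h ∧
      IsCrossed (ZMod p) q D ∧ (∀ x, q (h x) = π x) ∧ ∀ j, D (h (freeProPGen p d j)) = y j := by
  let E := Multiplicative W ⋊[groupRingAct p P W] P
  let tE : TopologicalSpace E := ⊥
  have dE : DiscreteTopology E := ⟨rfl⟩
  have hfin : Finite E := Finite.of_equiv _ SemidirectProduct.equivProd.symm
  have hE : IsPGroup p E := by
    obtain ⟨a, ha⟩ := IsPGroup.iff_card.1 hP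
    have : Module.Finite (ZMod p) W := Module.Finite.of_finite
    refine IsPGroup.of_card (n := Module.finrank (ZMod p) W + a) ?_
    rw [SemidirectProduct.card, ha, pow_add]
    congr 1
    exact (Module.natCard_eq_pow_finrank (K := ZMod p) (V := W)).trans (by rw [Nat.card_zmod])
  obtain ⟨h, hc, hj⟩ := exists_continuous_lift p d hE
    (fun j => ⟨.ofAdd (y j), π (freeProPGen p d j)⟩)
  refine ⟨E, inferInstance, tE, dE, h, SemidirectProduct.rightHom, fun z => z.left.toAdd, hc, ?_,
    ?_, ?_⟩
  · intro a b
    rfl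
  · have hc2 : Continuous (SemidirectProduct.rightHom : E →* P) := continuous_of_discreteTopology
    have : (SemidirectProduct.rightHom : E →* P).comp h = π := by
      refine monoidHom_ext_freeProPGen (hc2.comp hc) hπ fun j => ?_
      change (h _).right = _
      rw [hj]
    exact DFunLike.congr_fun this
  · intro j
    change (h _).left.toAdd = _
    rw [hj]
    rfl

end Semidirect
variable {p : ℕ} [Fact p.Prime] {P : Type u} [Group P] {W : Type u} {F E : Type*} [Group F] [Group E]
  [AddCommGroup W] [Module (ZMod p) W] [Module (MonoidAlgebra (ZMod p) P) W]
  [IsScalarTower (ZMod p) (MonoidAlgebra (ZMod p) P) W]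

omit [Module (ZMod p) W] [IsScalarTower (ZMod p) (MonoidAlgebra (ZMod p) P) W] in
theorem of_smul_sub_mem (g : P) (w : W) : MonoidAlgebra.of (ZMod p) P g • w - w ∈
    (augI (ZMod p) P • ⊤ : Submodule (MonoidAlgebra (ZMod p) P) W) := by
  have : (MonoidAlgebra.of (ZMod p) P g - 1) • w ∈
      (augI (ZMod p) P • ⊤ : Submodule (MonoidAlgebra (ZMod p) P) W) :=
    Submodule.smul_mem_smul (of_sub_one_mem_augI g) trivial
  rwa [sub_smul, one_smul] at this

/-- A crossed homomorphism maps a normal subgroup on which the action is trivial onto a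
submodule. -/
noncomputable def crossedImage {π : F →* P} {δ : F → W} (hδ : IsCrossed (ZMod p) π δ)
    (hπs : Function.Surjective π) (R : Subgroup F) [R.Normal] (hR : R ≤ π.ker) :
    Submodule (MonoidAlgebra (ZMod p) P) W :=
  let C : AddSubmonoid W :=
    { carrier := δ '' R
      zero_mem' := ⟨1, R.one_mem, hδ.map_one⟩
      add_mem' := by
        rintro _ _ ⟨x, hx, rfl⟩ ⟨y, hy, rfl⟩
        exact ⟨x * y, R.mul_mem hx hy, hδ.map_mul_of_eq_one (hR hx) y⟩ }
  { C with
    smul_mem' := by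
      intro u w hw
      change w ∈ C at hw
      change u • w ∈ C
      induction u using MonoidAlgebra.induction_on with
      | of g =>
        obtain ⟨x, hx, rfl⟩ := hw
        obtain ⟨y, rfl⟩ := hπs g
        exact ⟨y * x * y⁻¹, ‹R.Normal›.conj_mem x hx y, hδ.map_conj y (hR hx)⟩
      | add u v hu hv => rw [add_smul]; exact add_mem hu hv
      | smul c u hu =>
        rw [smul_assoc, ← ZMod.natCast_zmod_val c, Nat.cast_smul_eq_nsmul]
        exact nsmul_mem hu _ }

variable [TopologicalSpace F] [TopologicalSpace E] [DiscreteTopology E]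

/-- If continuous homomorphisms to `ℤ/p` vanish on `R`, so do crossed homomorphisms modulo the
augmentation ideal. -/
theorem crossed_mem_smul_top {h : F →* E} {q : E →* P} {D : E → W} (hc : Continuous h)
    (hD : IsCrossed (ZMod p) q D) {R : Subgroup F}
    (hR1 : ∀ ψ : F → ZMod p, Continuous ψ → (∀ x y, ψ (x * y) = ψ x + ψ y) → ∀ x ∈ R, ψ x = 0)
    {x : F} (hx : x ∈ R) :
    D (h x) ∈ (augI (ZMod p) P • ⊤ : Submodule (MonoidAlgebra (ZMod p) P) W) := by
  rw [← Submodule.Quotient.mk_eq_zero, ← Module.forall_dual_apply_eq_zero_iff (ZMod p)]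
  intro θ
  let ψ₀ : E → ZMod p := fun z => θ (Submodule.Quotient.mk (D z))
  refine hR1 (fun y => ψ₀ (h y)) ((continuous_of_discreteTopology (f := ψ₀)).comp hc) ?_ x hx
  intro y z
  change θ (Submodule.Quotient.mk (D (h (y * z)))) = θ (Submodule.Quotient.mk (D (h y))) +
    θ (Submodule.Quotient.mk (D (h z)))
  rw [← map_add, ← Submodule.Quotient.mk_add]
  congr 1
  rw [Submodule.Quotient.eq, map_mul, hD]
  convert of_smul_sub_mem (q (h y)) (D (h z)) using 1
  rw [add_sub_add_left_eq_sub]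

theorem finrank_coinvariants_le {h : F →* E} {q : E →* P} {D : E → W} (hc : Continuous h)
    (hD : IsCrossed (ZMod p) q D) {π : F →* P} (hπ : ∀ x, q (h x) = π x)
    (hδ : IsCrossed (ZMod p) π (fun x => D (h x)))
    (hπs : Function.Surjective π) (R : Subgroup F) [R.Normal] (hR : R ≤ π.ker) [Finite W] {r : ℕ}
    (hR2 : ∀ (V : Type u) [AddCommGroup V] [Module (ZMod p) V] (χ : V →ₗ[ZMod p] (F → ZMod p)),
      (∀ v, Continuous (χ v)) →
      (∀ v, ∀ x y, ∀ a ∈ R, ∀ b ∈ R, χ v (x * a) + χ v (y * b) - χ v (x * a * (y * b)) =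
        χ v x + χ v y - χ v (x * y)) →
      (∀ v, (∀ a ∈ R, χ v a = χ v 1) → v = 0) → Module.finrank (ZMod p) V ≤ r) :
    Module.finrank (ZMod p) (crossedImage hδ hπs R hR ⧸
      (augI (ZMod p) P • ⊤ : Submodule (MonoidAlgebra (ZMod p) P) (crossedImage hδ hπs R hR)))
      ≤ r := by
  set C := crossedImage hδ hπs R hR
  set IC := (augI (ZMod p) P • ⊤ : Submodule (MonoidAlgebra (ZMod p) P) C)
  rw [← Subspace.dual_finrank_eq]
  let S : Subgroup E := R.map h
  let o : E → E := fun z => (Quotient.out (QuotientGroup.mk z : E ⧸ S))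
  have ho : ∀ z, (o z)⁻¹ * z ∈ S := fun z => QuotientGroup.leftRel_apply.1
    (Quotient.exact (Quotient.out_eq (QuotientGroup.mk z : E ⧸ S)))
  have hoS : ∀ z, ∀ s ∈ S, o (z * s) = o z := by
    intro z s hs
    change Quotient.out (QuotientGroup.mk (z * s) : E ⧸ S) = _
    rw [QuotientGroup.mk_mul_of_mem z hs]
  have hDS : ∀ s ∈ S, D s ∈ C := by
    rintro _ ⟨x, hx, rfl⟩
    exact ⟨x, hx, rfl⟩
  have hRS : ∀ x ∈ R, h x ∈ S := fun x hx => Subgroup.mem_map_of_mem h hx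
  have hqS : ∀ s ∈ S, q s = 1 := by
    rintro _ ⟨x, hx, rfl⟩
    rw [hπ]; exact hR hx
  let κ : E → C := fun z => ⟨D ((o z)⁻¹ * z), hDS _ (ho z)⟩
  have hκ : ∀ z, ∀ s, (hs : s ∈ S) → κ (z * s) = κ z + ⟨D s, hDS s hs⟩ := by
    intro z s hs
    apply Subtype.ext
    change D ((o (z * s))⁻¹ * (z * s)) = D ((o z)⁻¹ * z) + D s
    rw [hoS z s hs, ← mul_assoc, hD.map_mul_of_eq_one (hqS _ (ho z))]
  let χ : Module.Dual (ZMod p) (C ⧸ IC) →ₗ[ZMod p] (F → ZMod p) :=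
    { toFun := fun v x => v (Submodule.Quotient.mk (κ (h x)))
      map_add' := fun _ _ => rfl
      map_smul' := fun _ _ => rfl }
  have hχ : ∀ v x a, (ha : a ∈ R) → χ v (x * a) = χ v x +
      v (Submodule.Quotient.mk ⟨D (h a), hDS _ (hRS a ha)⟩) := by
    intro v x a ha
    change v _ = v _ + v _
    rw [map_mul, hκ _ _ (hRS a ha), Submodule.Quotient.mk_add, map_add]
  refine hR2 _ χ ?_ ?_ ?_
  · intro v
    exact (continuous_of_discreteTopology
      (f := fun z : E => v (Submodule.Quotient.mk (κ z)))).comp hc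
  · intro v x y a ha b hb
    have hab : y⁻¹ * a * y⁻¹⁻¹ ∈ R := ‹R.Normal›.conj_mem a ha y⁻¹
    have h1 : x * a * (y * b) = x * y * (y⁻¹ * a * y⁻¹⁻¹) * b := by group
    rw [h1, hχ v (x * y * (y⁻¹ * a * y⁻¹⁻¹)) b hb, hχ v (x * y) _ hab, hχ v x a ha, hχ v y b hb]
    have h2 : v (Submodule.Quotient.mk ⟨D (h (y⁻¹ * a * y⁻¹⁻¹)), hDS _ (hRS _ hab)⟩) =
        v (Submodule.Quotient.mk ⟨D (h a), hDS _ (hRS a ha)⟩) := by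
      congr 1
      rw [Submodule.Quotient.eq]
      convert of_smul_sub_mem (π y⁻¹) (⟨D (h a), hDS _ (hRS a ha)⟩ : C) using 1
      apply Subtype.ext
      change D (h (y⁻¹ * a * y⁻¹⁻¹)) - D (h a) =
        MonoidAlgebra.of (ZMod p) P (π y⁻¹) • D (h a) - D (h a)
      congr 1
      exact hδ.map_conj y⁻¹ (hR ha)
    rw [h2]
    ring
  · intro v hv
    have hzero : ∀ w : C, v (Submodule.Quotient.mk w) = 0 := by
      rintro ⟨w, hw⟩
      obtain ⟨x, hx, hxw⟩ := hw
      have h1 := hχ v 1 x hx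
      rw [one_mul, hv x hx] at h1
      have h2 := left_eq_add.1 h1
      rw [← h2]
      congr 2
      exact Subtype.ext hxw.symm
    refine LinearMap.ext fun z => ?_
    obtain ⟨w, rfl⟩ := Submodule.Quotient.mk_surjective _ z
    exact hzero w

/-- The dimension of the quotient of the group algebra by a power of the augmentation ideal. -/
noncomputable def augDim (p : ℕ) (P : Type*) [Group P] (n : ℕ) : ℕ :=
  Module.finrank (ZMod p) (MonoidAlgebra (ZMod p) P ⧸ augI (ZMod p) P ^ n)

theorem pow_smul_top_pi_quotient {A : Type*} [Ring A] (I : Ideal A) [I.IsTwoSided] (N d : ℕ) :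
    (I ^ N • ⊤ : Submodule A (Fin d → A ⧸ I ^ N)) = ⊥ := by
  rw [eq_bot_iff, Submodule.smul_le]
  intro a ha w _
  rw [Submodule.mem_bot]
  funext j
  obtain ⟨b, hb⟩ := Submodule.Quotient.mk_surjective _ (w j)
  rw [Pi.smul_apply, ← hb, ← Submodule.Quotient.mk_smul, Pi.zero_apply,
    Submodule.Quotient.mk_eq_zero]
  exact Ideal.mul_mem_right b _ ha

theorem smul_eq_zero_of_mem_pow_smul_top {A W : Type*} [Ring A] [AddCommGroup W] [Module A W]
    {I : Ideal A} [I.IsTwoSided] {N m n : ℕ} (hN : (I ^ N • ⊤ : Submodule A W) = ⊥)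
    (h : N ≤ m + n) {w : W} (hw : w ∈ (I ^ n • ⊤ : Submodule A W)) {u : A} (hu : u ∈ I ^ m) :
    u • w = 0 := by
  have h1 := Submodule.smul_mem_smul hu hw
  rw [pow_smul_pow_smul] at h1
  have h2 : (I ^ (m + n) • ⊤ : Submodule A W) ≤ I ^ N • ⊤ :=
    Submodule.smul_mono_left (Ideal.pow_le_pow_right h)
  have h3 := h2 h1
  rwa [hN, Submodule.mem_bot] at h3

theorem span_pi_single_eq_top {A : Type*} [Ring A] (I : Ideal A) (d : ℕ) :
    Submodule.span A (Set.range fun j : Fin d =>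
      (Pi.single j (Submodule.Quotient.mk 1) : Fin d → A ⧸ I)) = ⊤ := by
  rw [eq_top_iff]
  intro w _
  rw [← Finset.univ_sum_single w]
  refine sum_mem fun j _ => ?_
  obtain ⟨b, hb⟩ := Submodule.Quotient.mk_surjective _ (w j)
  have : (Pi.single j (w j) : Fin d → A ⧸ I) = b • Pi.single j (Submodule.Quotient.mk 1) := by
    rw [← Pi.single_smul, ← hb, ← Submodule.Quotient.mk_smul, smul_eq_mul, mul_one]
  rw [this]
  exact Submodule.smul_mem _ _ (Submodule.subset_span ⟨j, rfl⟩)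

variable {p : ℕ} [Fact p.Prime] {P : Type u} [Group P] {W : Type u}
  [AddCommGroup W] [Module (ZMod p) W] [Module (MonoidAlgebra (ZMod p) P) W]
  [IsScalarTower (ZMod p) (MonoidAlgebra (ZMod p) P) W]

/-- The dimension of a quotient of the target of a crossed homomorphism of `F` which factors
through `P`. -/
theorem finrank_quotient_add_one_le [Finite P] [Finite W] {F E : Type*} [Group F] [Group E]
    [TopologicalSpace F] [TopologicalSpace E]
    [DiscreteTopology E] {h : F →* E} {q : E →* P} {D : E → W} (hc : Continuous h)
    (hD : IsCrossed (ZMod p) q D) (hqs : Function.Surjective (q.comp h))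
    (hspan : Submodule.span (MonoidAlgebra (ZMod p) P) (Set.range fun x => D (h x)) = ⊤)
    (N : ℕ) (hN : (augI (ZMod p) P ^ N • ⊤ : Submodule (MonoidAlgebra (ZMod p) P) W) = ⊥)
    (Y : Submodule (MonoidAlgebra (ZMod p) P) W)
    (hY : ∀ L : Subgroup F, L.Normal → IsClosed (L : Set F) →
      (∀ x, q (h x) = 1 → D (h x) ∈ Y → x ∈ L) → (q.comp h).ker ≤ L) :
    Module.finrank (ZMod p) (W ⧸ Y) + 1 ≤ augDim p P (N + 1) := by
  have hδ : ∀ x y, D (h (x * y)) = D (h x) + MonoidAlgebra.of (ZMod p) P (q (h x)) • D (h y) := by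
    intro x y
    rw [map_mul, hD]
  have hδ' : IsCrossed (ZMod p) (q.comp h) (fun x => D (h x)) := hδ
  let L : Subgroup F :=
    { carrier := {x | q (h x) = 1 ∧ D (h x) ∈ Y}
      one_mem' := ⟨by simp, by rw [map_one, hD.map_one]; exact Y.zero_mem⟩
      mul_mem' := by
        rintro x y ⟨hx, hx'⟩ ⟨hy, hy'⟩
        refine ⟨by rw [map_mul, map_mul, hx, hy, mul_one], ?_⟩
        rw [hδ]
        exact Y.add_mem hx' (Y.smul_mem _ hy')
      inv_mem' := by
        rintro x ⟨hx, hx'⟩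
        have h1 : q (h x⁻¹) = 1 := by rw [map_inv, map_inv, hx, inv_one]
        refine ⟨h1, ?_⟩
        have h2 := hδ'.map_inv x
        rw [show (q.comp h) x = 1 from hx, map_one, one_smul] at h2
        rw [h2]
        exact Y.neg_mem hx' }
  have hLn : L.Normal := by
    refine ⟨fun x hx y => ⟨?_, ?_⟩⟩
    · rw [map_mul, map_mul, map_mul, map_mul, hx.1, mul_one, ← map_mul, ← map_mul, mul_inv_cancel,
        map_one, map_one]
    · have := hδ'.map_conj y hx.1
      rw [this]
      exact Y.smul_mem _ hx.2
  have hLc : IsClosed (L : Set F) :=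
    (isClosed_discrete {z : E | q z = 1 ∧ D z ∈ Y}).preimage hc
  have hL := hY L hLn hLc fun x h1 h2 => ⟨h1, h2⟩
  let DP : P → W ⧸ Y := fun g => Submodule.Quotient.mk (D (h (Function.surjInv hqs g)))
  have hDP : ∀ x, DP (q (h x)) = Submodule.Quotient.mk (D (h x)) := by
    intro x
    set s := Function.surjInv hqs (q (h x)) with hs
    have h1 : q (h s) = q (h x) := Function.surjInv_eq hqs (q (h x))
    have h2 : s⁻¹ * x ∈ L := hL (by
      rw [MonoidHom.mem_ker, map_mul, map_inv]
      exact inv_mul_eq_one.2 h1)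
    have h3 := hδ s (s⁻¹ * x)
    rw [mul_inv_cancel_left] at h3
    rw [h3, Submodule.Quotient.mk_add]
    refine left_eq_add.2 ?_
    rw [Submodule.Quotient.mk_eq_zero]
    exact Y.smul_mem _ h2.2
  refine finrank_add_one_le_of_crossed (D := DP) ?_ ?_ N ?_
  · intro g g'
    obtain ⟨x, rfl⟩ := hqs g
    obtain ⟨y, rfl⟩ := hqs g'
    rw [← map_mul]
    change DP (q (h _)) = DP (q (h _)) + MonoidAlgebra.of (ZMod p) P (q (h x)) • DP (q (h _))
    rw [hDP, hDP, hDP, hδ, Submodule.Quotient.mk_add, Submodule.Quotient.mk_smul]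
  · rw [eq_top_iff, ← Submodule.range_mkQ Y, LinearMap.range_eq_map, ← hspan, Submodule.map_span,
      Submodule.span_le]
    rintro _ ⟨_, ⟨x, rfl⟩, rfl⟩
    exact Submodule.subset_span ⟨q (h x), hDP x⟩
  · rw [← Submodule.range_mkQ Y, LinearMap.range_eq_map, ← Submodule.map_smul'', hN,
      Submodule.map_bot]

variable [Finite P] [TopologicalSpace P] [DiscreteTopology P]

/-- The inequality of Golod and Shafarevich between the dimensions of the quotients of the group
algebra of a finite `p`-group by the powers of its augmentation ideal. -/
theorem golod_shafarevich_step (hP : IsPGroup p P) {d : ℕ} {π : FreeProP p d →* P}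
    (hπ : Continuous π) (hπs : Function.Surjective π) (R : Subgroup (FreeProP p d)) [R.Normal]
    (hR : R ≤ π.ker) {r : ℕ}
    (hR1 : ∀ ψ : FreeProP p d → ZMod p, Continuous ψ → (∀ x y, ψ (x * y) = ψ x + ψ y) →
      ∀ x ∈ R, ψ x = 0)
    (hR2 : ∀ (V : Type u) [AddCommGroup V] [Module (ZMod p) V]
      (χ : V →ₗ[ZMod p] (FreeProP p d → ZMod p)),
      (∀ v, Continuous (χ v)) →
      (∀ v, ∀ x y, ∀ a ∈ R, ∀ b ∈ R, χ v (x * a) + χ v (y * b) - χ v (x * a * (y * b)) =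
        χ v x + χ v y - χ v (x * y)) →
      (∀ v, (∀ a ∈ R, χ v a = χ v 1) → v = 0) → Module.finrank (ZMod p) V ≤ r)
    {ι : Type*} (f : ι → FreeProP p d) (hf : ∀ i, f i ∈ π.ker) (e : ι → ℕ) (he1 : ∀ i, 1 ≤ e i)
    (he : ∀ i, (e i : ℕ∞) ≤ depth p (f i)) (N : ℕ) (s : Finset ι) (hs : ∀ i ∉ s, N + 1 ≤ e i)
    (hM : ∀ L : Subgroup (FreeProP p d), L.Normal → IsClosed (L : Set (FreeProP p d)) → R ≤ L →
      (∀ i, f i ∈ L) → π.ker ≤ L) :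
    d * augDim p P N + 1 ≤ augDim p P (N + 1) + r * augDim p P (N + 1 - 2) +
      ∑ i ∈ s, augDim p P (N + 1 - e i) := by
  have hfinA : Finite (MonoidAlgebra (ZMod p) P) := Module.finite_of_finite (ZMod p)
  let W := Fin d → MonoidAlgebra (ZMod p) P ⧸ augI (ZMod p) P ^ N
  have hfinQ : Finite (MonoidAlgebra (ZMod p) P ⧸ augI (ZMod p) P ^ N) :=
    Finite.of_surjective _ (Submodule.Quotient.mk_surjective _)
  have hfinW : Finite W := inferInstanceAs (Finite (Fin d → _))
  have hN : (augI (ZMod p) P ^ N • ⊤ : Submodule (MonoidAlgebra (ZMod p) P) W) = ⊥ :=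
    pow_smul_top_pi_quotient _ N d
  obtain ⟨E, _, _, _, h, q, D, hc, hD, hqh, hDx⟩ := exists_isCrossed (W := W) hP hπ
    (fun j => Pi.single j (Submodule.Quotient.mk 1))
  have hπq : q.comp h = π := MonoidHom.ext hqh
  have hδ : IsCrossed (ZMod p) π (fun x => D (h x)) := by
    intro x y
    change D (h (x * y)) = D (h x) + MonoidAlgebra.of (ZMod p) P (π x) • D (h y)
    rw [map_mul, hD, hqh]
  let C := crossedImage hδ hπs R hR
  have hCr := finrank_coinvariants_le hc hD hqh hδ hπs R hR hR2
  have hNC : (augI (ZMod p) P ^ N • ⊤ : Submodule (MonoidAlgebra (ZMod p) P) C) = ⊥ := by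
    rw [eq_bot_iff, Submodule.smul_le]
    intro a ha w _
    rw [Submodule.mem_bot]
    apply Subtype.ext
    have : a • w.1 ∈ (augI (ZMod p) P ^ N • ⊤ : Submodule (MonoidAlgebra (ZMod p) P) W) :=
      Submodule.smul_mem_smul ha trivial
    rwa [hN, Submodule.mem_bot] at this
  obtain ⟨c, hc'⟩ := exists_span_range_eq_top_of_nilpotent (k := ZMod p) (augI (ZMod p) P) N hNC
  have hcI : ∀ i, ((c i : C) : W) ∈
      (augI (ZMod p) P ^ 1 • ⊤ : Submodule (MonoidAlgebra (ZMod p) P) W) := by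
    intro i
    rw [Submodule.pow_one]
    obtain ⟨x, hx, hxc⟩ := (c i).2
    rw [← hxc]
    exact crossed_mem_smul_top hc hD hR1 hx
  have hfI : ∀ i, D (h (f i)) ∈
      (augI (ZMod p) P ^ (e i - 1) • ⊤ : Submodule (MonoidAlgebra (ZMod p) P) W) := by
    intro i
    have h1 := linExt_mem_pow_smul_top hD (e i - 1) _
      ((Nat.sub_add_cancel (he1 i)).symm ▸ of_sub_one_mem_of_le_depth hc (he i))
    rwa [map_sub, linExt_of, ← (MonoidAlgebra.of (ZMod p) E).map_one, linExt_of, hD.map_one,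
      sub_zero] at h1
  let v : Fin (Module.finrank (ZMod p) (C ⧸ (augI (ZMod p) P • ⊤ :
    Submodule (MonoidAlgebra (ZMod p) P) C))) ⊕ s → W :=
    Sum.elim (fun i => (c i : W)) (fun i => D (h (f i)))
  let J : Fin (Module.finrank (ZMod p) (C ⧸ (augI (ZMod p) P • ⊤ :
    Submodule (MonoidAlgebra (ZMod p) P) C))) ⊕ s → Ideal (MonoidAlgebra (ZMod p) P) :=
    Sum.elim (fun _ => augI (ZMod p) P ^ (N + 1 - 2)) (fun i => augI (ZMod p) P ^ (N + 1 - e i))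
  have hJ : ∀ i, ∀ u ∈ J i, u • v i = 0 := by
    rintro (i | i) u hu
    · exact smul_eq_zero_of_mem_pow_smul_top hN (by omega) (hcI i) hu
    · exact smul_eq_zero_of_mem_pow_smul_top hN (by have := he1 i; omega) (hfI i) hu
  have hYdim := finrank_span_range_le (k := ZMod p) v J hJ
  set Y := Submodule.span (MonoidAlgebra (ZMod p) P) (Set.range v)
  have hCY : C ≤ Y := by
    have h1 : Submodule.map C.subtype ⊤ ≤ Y := by
      rw [← hc', Submodule.map_span, Submodule.span_le]
      rintro _ ⟨_, ⟨i, rfl⟩, rfl⟩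
      exact Submodule.subset_span ⟨Sum.inl i, rfl⟩
    rwa [Submodule.map_subtype_top] at h1
  have hfY : ∀ i, D (h (f i)) ∈ Y := by
    intro i
    by_cases hi : i ∈ s
    · exact Submodule.subset_span ⟨Sum.inr ⟨i, hi⟩, rfl⟩
    · have h1 := smul_eq_zero_of_mem_pow_smul_top (m := 0) hN (by have := hs i hi; omega) (hfI i)
        (u := 1) (by rw [Submodule.pow_zero, Ideal.one_eq_top]; trivial)
      rw [one_smul] at h1
      rw [h1]
      exact Y.zero_mem
  have hspan : Submodule.span (MonoidAlgebra (ZMod p) P) (Set.range fun x => D (h x)) = ⊤ := by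
    rw [eq_top_iff, ← span_pi_single_eq_top (augI (ZMod p) P ^ N) d]
    refine Submodule.span_mono ?_
    rintro _ ⟨j, rfl⟩
    exact ⟨_, hDx j⟩
  have hB := finrank_quotient_add_one_le hc hD (hπq ▸ hπs) hspan N hN Y (by
    intro L hLn hLc hL
    rw [hπq]
    exact hM L hLn hLc (fun x hx => hL x (by rw [hqh]; exact hR hx) (hCY ⟨x, hx, rfl⟩))
      (fun i => hL _ (by rw [hqh]; exact hf i) (hfY i)))
  have hW : Module.finrank (ZMod p) (W ⧸ Y) + Module.finrank (ZMod p) Y = d * augDim p P N := by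
    have h1 := Submodule.finrank_quotient_add_finrank (Y.restrictScalars (ZMod p))
    rw [(Submodule.Quotient.restrictScalarsEquiv (ZMod p) Y).finrank_eq] at h1
    refine h1.trans ?_
    rw [Module.finrank_pi_fintype]
    simp [augDim]
  have hsum : ∑ i, Module.finrank (ZMod p) (MonoidAlgebra (ZMod p) P ⧸ J i) ≤
      r * augDim p P (N + 1 - 2) + ∑ i ∈ s, augDim p P (N + 1 - e i) := by
    rw [Fintype.sum_sum_type]
    refine add_le_add ?_ ?_
    · exact ((Fin.sum_const _ (augDim p P (N + 1 - 2))).trans (smul_eq_mul _ _)).le.trans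
        (Nat.mul_le_mul_right _ hCr)
    · exact (Finset.sum_coe_sort s (fun i => augDim p P (N + 1 - e i))).le
  omega

/-- A bounded nonnegative sequence cannot satisfy the Golod-Shafarevich inequalities if the
associated series takes a nonpositive value. -/
theorem false_of_golod_shafarevich {c b : ℕ → ℝ} {d t B q : ℝ} (hc0 : c 0 = 0)
    (hcn : ∀ n, 0 ≤ c n) (hcB : ∀ n, c n ≤ B) (ht0 : 0 < t) (ht1 : t < 1)
    (hq : HasSum (fun n => b n * t ^ n) q) (hneg : 1 - d * t + q ≤ 0)
    (h : ∀ n, d * c n + 1 ≤ c (n + 1) +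
      ∑ ij ∈ Finset.HasAntidiagonal.antidiagonal (n + 1), b ij.1 * c ij.2) : False := by
  have hB : 0 ≤ B := (hcn 0).trans (hcB 0)
  have hgeo := summable_geometric_of_lt_one ht0.le ht1
  have hs : Summable (fun n => c n * t ^ n) :=
    Summable.of_nonneg_of_le (fun n => mul_nonneg (hcn n) (pow_nonneg ht0.le n))
      (fun n => mul_le_mul_of_nonneg_right (hcB n) (pow_nonneg ht0.le n)) (hgeo.mul_left B)
  obtain ⟨H, hH⟩ := hs
  have hH0 : 0 ≤ H := hH.nonneg fun n => mul_nonneg (hcn n) (pow_nonneg ht0.le n)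
  have hprod : HasSum (fun n => ∑ ij ∈ Finset.HasAntidiagonal.antidiagonal n,
      (b ij.1 * t ^ ij.1) * (c ij.2 * t ^ ij.2)) (q * H) := by
    have h1 : Summable (fun n => ‖b n * t ^ n‖) := hq.summable.abs
    have h2 : Summable (fun n => ‖c n * t ^ n‖) := hH.summable.abs
    have h3 := tsum_mul_tsum_eq_tsum_sum_antidiagonal_of_summable_norm h1 h2
    rw [hq.tsum_eq, hH.tsum_eq] at h3
    rw [h3]
    exact (summable_norm_sum_mul_antidiagonal_of_summable_norm h1 h2).of_norm.hasSum
  have hprod' : HasSum (fun n => (∑ ij ∈ Finset.HasAntidiagonal.antidiagonal n, b ij.1 * c ij.2) * t ^ n)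
      (q * H) := by
    refine hprod.congr_fun ?_
    intro n
    rw [Finset.sum_mul]
    refine Finset.sum_congr rfl fun ij hij => ?_
    rw [← Finset.HasAntidiagonal.mem_antidiagonal.1 hij, pow_add]
    ring
  have hprod1 := (hasSum_nat_add_iff' 1).2 hprod'
  have hH1 := (hasSum_nat_add_iff' 1).2 hH
  simp only [Finset.range_one, Finset.sum_singleton, hc0, zero_mul, sub_zero,
    Finset.HasAntidiagonal.antidiagonal_zero, mul_zero] at hprod1 hH1
  have hl : HasSum (fun n => t * (d * (c n * t ^ n)) + t * t ^ n)
      (t * (d * H) + t * (1 - t)⁻¹) :=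
    ((hH.mul_left d).mul_left t).add ((hasSum_geometric_of_lt_one ht0.le ht1).mul_left t)
  have hle := hasSum_le (fun n => ?_) hl (hH1.add hprod1)
  · have h1 : 0 < t * (1 - t)⁻¹ := mul_pos ht0 (inv_pos.2 (sub_pos.2 ht1))
    have h2 : (1 - d * t + q) * H ≤ 0 := mul_nonpos_of_nonpos_of_nonneg hneg hH0
    nlinarith
  · have h1 := mul_le_mul_of_nonneg_right (h n) (pow_nonneg ht0.le (n + 1))
    calc t * (d * (c n * t ^ n)) + t * t ^ n = (d * c n + 1) * t ^ (n + 1) := by ring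
      _ ≤ _ := h1
      _ = _ := by ring

section Presentation

variable {p : ℕ} [Fact p.Prime] {G : Type u} [Group G] [TopologicalSpace G] [IsTopologicalGroup G]

theorem eq_of_additive_of_eq_on_gens {d : ℕ} {ψ ψ' : FreeProP p d → ZMod p} (hc : Continuous ψ)
    (hc' : Continuous ψ') (h : ∀ x y, ψ (x * y) = ψ x + ψ y)
    (h' : ∀ x y, ψ' (x * y) = ψ' x + ψ' y)
    (heq : ∀ j, ψ (freeProPGen p d j) = ψ' (freeProPGen p d j)) : ψ = ψ' := by
  let Ψ : FreeProP p d →* Multiplicative (ZMod p) :=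
    MonoidHom.mk' (fun x => Multiplicative.ofAdd (ψ x)) fun x y => congrArg _ (h x y)
  let Ψ' : FreeProP p d →* Multiplicative (ZMod p) :=
    MonoidHom.mk' (fun x => Multiplicative.ofAdd (ψ' x)) fun x y => congrArg _ (h' x y)
  have := monoidHom_ext_freeProPGen (f := Ψ) (g := Ψ') (continuous_ofAdd.comp hc)
    (continuous_ofAdd.comp hc') fun j => congrArg Multiplicative.ofAdd (heq j)
  exact funext fun x => congrArg Multiplicative.toAdd (DFunLike.congr_fun this x)

/-- Continuous homomorphisms to `ℤ/p` vanish on the relations of a minimal presentation. -/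
theorem additive_eq_zero_of_mem_ker {d : ℕ} (hd : d = generatorRank p G) {φ : FreeProP p d →* G}
    (hφc : Continuous φ) (hφs : Function.Surjective φ) {ψ : FreeProP p d → ZMod p}
    (hc : Continuous ψ) (h : ∀ x y, ψ (x * y) = ψ x + ψ y) {x : FreeProP p d} (hx : x ∈ φ.ker) :
    ψ x = 0 := by
  obtain ⟨ψ', hc', h', heq⟩ := exists_continuous_additive_of_generatorRank hd
    (fun j => φ (freeProPGen p d j)) (fun θ hθc hθ hθ0 g => by
      obtain ⟨y, rfl⟩ := hφs g
      exact congrFun (eq_of_additive_of_eq_on_gens (ψ := fun y => θ (φ y)) (ψ' := fun _ => 0)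
        (hθc.comp hφc) continuous_const (fun x y => by rw [map_mul, hθ]) (fun _ _ => by simp)
        hθ0) y)
    (fun j => ψ (freeProPGen p d j))
  have := congrFun (eq_of_additive_of_eq_on_gens hc (hc'.comp hφc) h
    (fun x y => by simp only [Function.comp_apply, map_mul, h']) (fun j => (heq j).symm)) x
  rw [this, Function.comp_apply, hx]
  have h1 := h' 1 1
  rw [mul_one] at h1
  exact left_eq_add.1 h1

/-- Functions on a group extension whose coboundary is inflated from the quotient are detected by
the second cohomology of the quotient. -/
theorem finrank_le_relationRank_of_extension [T2Space G] {F : Type*} [Group F] [TopologicalSpace F]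
    [IsTopologicalGroup F] [CompactSpace F] {φ : F →* G} (hφc : Continuous φ)
    (hφs : Function.Surjective φ) (hr : relationRank p G ≠ 0)
    (hψ : ∀ ψ : F → ZMod p, Continuous ψ → (∀ x y, ψ (x * y) = ψ x + ψ y) → ∀ x ∈ φ.ker, ψ x = 0)
    (V : Type*) [AddCommGroup V] [Module (ZMod p) V] (χ : V →ₗ[ZMod p] (F → ZMod p))
    (hχc : ∀ v, Continuous (χ v))
    (hχ : ∀ v, ∀ x y, ∀ a ∈ φ.ker, ∀ b ∈ φ.ker,
      χ v (x * a) + χ v (y * b) - χ v (x * a * (y * b)) = χ v x + χ v y - χ v (x * y))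
    (hinj : ∀ v, (∀ a ∈ φ.ker, χ v a = χ v 1) → v = 0) :
    Module.finrank (ZMod p) V ≤ relationRank p G := by
  let s := Function.surjInv hφs
  have hs : ∀ x, ∃ a ∈ φ.ker, x = s (φ x) * a := by
    intro x
    refine ⟨(s (φ x))⁻¹ * x, ?_, by group⟩
    rw [MonoidHom.mem_ker, map_mul, map_inv, Function.surjInv_eq hφs, inv_mul_cancel]
  let z₀ : V → G × G → ZMod p := fun v q => χ v (s q.1) + χ v (s q.2) - χ v (s q.1 * s q.2)
  have hz₀ : ∀ v x y, z₀ v (φ x, φ y) = χ v x + χ v y - χ v (x * y) := by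
    intro v x y
    obtain ⟨a, ha, hxa⟩ := hs x
    obtain ⟨b, hb, hyb⟩ := hs y
    have h1 := hχ v (s (φ x)) (s (φ y)) a ha b hb
    rw [← hxa, ← hyb] at h1
    exact h1.symm
  have hq : Topology.IsQuotientMap (Prod.map φ φ) :=
    (hφc.prodMap hφc).isClosedMap.isQuotientMap (hφc.prodMap hφc) (hφs.prodMap hφs)
  have hz₀c : ∀ v, Continuous (z₀ v) := by
    intro v
    rw [hq.continuous_iff]
    have : z₀ v ∘ Prod.map φ φ = fun q : F × F => χ v q.1 + χ v q.2 - χ v (q.1 * q.2) :=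
      funext fun q => hz₀ v q.1 q.2
    rw [this]
    exact (((hχc v).comp continuous_fst).add ((hχc v).comp continuous_snd)).sub
      ((hχc v).comp continuous_mul)
  let z : V →ₗ[ZMod p] C(G × G, ZMod p) :=
    { toFun := fun v => ⟨z₀ v, hz₀c v⟩
      map_add' := fun v w => by
        ext q
        change χ (v + w) _ + χ (v + w) _ - χ (v + w) _ = (χ v _ + χ v _ - χ v _) +
          (χ w _ + χ w _ - χ w _)
        simp only [map_add, Pi.add_apply]
        ring
      map_smul' := fun c v => by
        ext q
        change χ (c • v) _ + χ (c • v) _ - χ (c • v) _ = c * (χ v _ + χ v _ - χ v _)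
        simp only [map_smul, Pi.smul_apply, smul_eq_mul]
        ring }
  refine finrank_le_relationRank z ?_ ?_ hr
  · intro v a b c
    obtain ⟨x, rfl⟩ := hφs a
    obtain ⟨y, rfl⟩ := hφs b
    obtain ⟨w, rfl⟩ := hφs c
    rw [← map_mul, ← map_mul]
    change z₀ v _ - z₀ v _ + z₀ v _ - z₀ v _ = 0
    rw [hz₀, hz₀, hz₀, hz₀, mul_assoc]
    ring
  · intro v β hβ hβz
    refine hinj v fun a ha => ?_
    have hadd : ∀ x y, χ v (x * y) - β (φ (x * y)) =
        (χ v x - β (φ x)) + (χ v y - β (φ y)) := by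
      intro x y
      have h1 : z₀ v (φ x, φ y) = _ := hβz (φ x) (φ y)
      rw [hz₀] at h1
      rw [map_mul]
      linear_combination -h1
    have hker : ∀ x ∈ φ.ker, χ v x = β 1 := by
      intro x hx
      have h1 := hψ (fun x => χ v x - β (φ x)) ((hχc v).sub (hβ.comp hφc)) hadd x hx
      change χ v x - β (φ x) = 0 at h1
      rw [MonoidHom.mem_ker.1 hx] at h1
      exact sub_eq_zero.1 h1
    rw [hker a ha, hker 1 (one_mem _)]

end Presentation

theorem augDim_zero (p : ℕ) [Fact p.Prime] (P : Type*) [Group P] : augDim p P 0 = 0 := by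
  have : Subsingleton (MonoidAlgebra (ZMod p) P ⧸ augI (ZMod p) P ^ 0) := by
    rw [Submodule.pow_zero, Ideal.one_eq_top]
    exact Submodule.Quotient.subsingleton_iff.2 rfl
  exact Module.finrank_zero_of_subsingleton

theorem augDim_le (p : ℕ) [Fact p.Prime] (P : Type*) [Group P] [Finite P] (n : ℕ) :
    augDim p P n ≤ Module.finrank (ZMod p) (MonoidAlgebra (ZMod p) P) := by
  let T : MonoidAlgebra (ZMod p) P →ₗ[ZMod p] MonoidAlgebra (ZMod p) P ⧸ augI (ZMod p) P ^ n :=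
    (Submodule.mkQ (augI (ZMod p) P ^ n)).restrictScalars (ZMod p)
  have hT : Function.Surjective T := Submodule.Quotient.mk_surjective _
  exact LinearMap.finrank_le_finrank_of_surjective hT

theorem cuttingBase_lt {a : ℝ} (ha : 1 < a) : (cuttingBase a : ℝ) < a := by
  have h1 : (⌊a⌋₊ : ℝ) ≤ a := Nat.floor_le (by linarith)
  unfold cuttingBase
  split_ifs with h
  · have h2 : 1 ≤ ⌊a⌋₊ := Nat.le_floor (by exact_mod_cast ha.le)
    rw [Nat.cast_sub h2, h]
    simp
  · exact lt_of_le_of_ne h1 h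

theorem hasSum_ite_le_pow {x : ℝ} (hx0 : 0 ≤ x) (hx1 : x < 1) (m : ℕ) :
    HasSum (fun n => if m ≤ n then x ^ n else 0) (x ^ m / (1 - x)) := by
  rw [← hasSum_nat_add_iff' m, Finset.sum_eq_zero fun i hi => if_neg (by
    have := Finset.mem_range.1 hi; omega), sub_zero]
  simp only [le_add_iff_nonneg_left, zero_le, if_true, pow_add]
  rw [div_eq_inv_mul]
  exact (hasSum_geometric_of_lt_one hx0 hx1).mul_right _

theorem sum_range_shift_eq_sum_antidiagonal (c : ℕ → ℝ) (hc : c 0 = 0) (l m : ℕ) (hm : 2 ≤ m)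
    (r : ℝ) (N : ℕ) :
    r * c (N + 1 - 2) + ∑ k ∈ Finset.range (N + 1), (l : ℝ) ^ (k + m) * c (N + 1 - (m + k)) =
      ∑ ij ∈ Finset.HasAntidiagonal.antidiagonal (N + 1),
        ((if ij.1 = 2 then r else 0) + (if m ≤ ij.1 then (l : ℝ) ^ ij.1 else 0)) * c ij.2 := by
  rw [Finset.Nat.sum_antidiagonal_eq_sum_range_succ_mk]
  have hext : ∀ g : ℕ → ℝ, (∑ i ∈ Finset.range (N + 1).succ, g i * c (N + 1 - i)) =
      ∑ i ∈ Finset.range (m + (N + 1)), g i * c (N + 1 - i) := by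
    intro g
    refine Finset.sum_subset (fun i hi => ?_) fun i _ hi => ?_
    · rw [Finset.mem_range] at *; omega
    · rw [Finset.mem_range] at hi
      rw [show N + 1 - i = 0 by omega, hc, mul_zero]
  rw [hext]
  simp only [add_mul, Finset.sum_add_distrib]
  congr 1
  · rw [Finset.sum_eq_single 2 (fun i _ hi => by rw [if_neg hi, zero_mul])
      (fun h => absurd (Finset.mem_range.2 (by omega)) h), if_pos rfl]
  · rw [Finset.sum_range_add _ m, Finset.sum_eq_zero (s := Finset.range m) fun i hi => by
      rw [if_neg (by have := Finset.mem_range.1 hi; omega), zero_mul], zero_add]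
    refine Finset.sum_congr rfl fun k _ => ?_
    rw [if_pos (by omega), add_comm k m]

end ProP

theorem mainTheorem7 (p : ℕ) [Fact p.Prime]
    (G : Type u) [Group G] [TopologicalSpace G] [IsTopologicalGroup G]
    (hG : ProP.IsProP p G) (hfp : ProP.IsFinitelyPresented p G)
    (d r : ℕ) (hd : d = ProP.generatorRank p G) (hr : r = ProP.relationRank p G)
    (φ : ProP.FreeProP p d →* G) (hφc : Continuous φ) (hφs : Function.Surjective φ)
    (hrd : (r : ℝ) < (d : ℝ) ^ 2 / 4)
    (a : ℝ) (ha : a = 2 * (r : ℝ) / (d : ℝ)) (ha1 : 1 < a)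
    (l : ℕ) (hl : l = ProP.cuttingBase a)
    (m : ℕ) (hm2 : 2 ≤ m)
    (hm : 1 - (d : ℝ) ^ 2 / (4 * (r : ℝ)) + ((l : ℝ) / a) ^ m / (1 - (l : ℝ) / a) < 0)
    (f : (k : ℕ) → Fin (l ^ (k + m)) → ProP.FreeProP p d)
    (hf : ∀ (k : ℕ) (j : Fin (l ^ (k + m))), ((m + k : ℕ) : ℕ∞) ≤ ProP.depth p (f k j)) :
    Infinite (G ⧸ (ProP.closedNormalClosure
      {x : ProP.FreeProP p d | ∃ (k : ℕ) (j : Fin (l ^ (k + m))), x = f k j}).map φ) := by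
  open ProP in
  have hT2 := hG.t2
  set S := {x : FreeProP p d | ∃ (k : ℕ) (j : Fin (l ^ (k + m))), x = f k j}
  set M := closedNormalClosure S
  have hMn : M.Normal := Subgroup.is_normal_topologicalClosure _
  have hMc : IsClosed (M : Set (FreeProP p d)) := Subgroup.isClosed_topologicalClosure _
  set K := M.map φ
  have hKn : K.Normal := hMn.map φ hφs
  have hKc : IsClosed (K : Set G) := (hMc.isCompact.image hφc).isClosed
  by_contra hinf
  have hfin : Finite (G ⧸ K) := not_infinite_iff_finite.1 hinf
  have hfi : K.FiniteIndex := Subgroup.finiteIndex_of_finite_quotient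
  have hKo : IsOpen (K : Set G) := Subgroup.isOpen_of_isClosed_of_finiteIndex K hKc
  have hP : IsPGroup p (G ⧸ K) := hG.isPGroup ⟨⟨K, hKo⟩, hKn⟩
  have hdisc : DiscreteTopology (G ⧸ K) := QuotientGroup.discreteTopology hKo
  let π : FreeProP p d →* G ⧸ K := (QuotientGroup.mk' K).comp φ
  have hπc : Continuous π := continuous_quot_mk.comp hφc
  have hπs : Function.Surjective π := (QuotientGroup.mk'_surjective K).comp hφs
  have hπker : ∀ x, x ∈ π.ker ↔ φ x ∈ K := fun x => QuotientGroup.eq_one_iff (φ x)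
  have hker : φ.ker ≤ π.ker := fun x hx => (hπker x).2 (by
    rw [MonoidHom.mem_ker.1 hx]; exact K.one_mem)
  have hSM : S ⊆ M := fun x hx =>
    Subgroup.le_topologicalClosure _ (Subgroup.subset_normalClosure hx)
  have hd0 : (d : ℝ) ≠ 0 := by
    intro h
    rw [ha, h, div_zero] at ha1
    linarith
  have hr0 : (r : ℝ) ≠ 0 := by
    intro h
    rw [ha, h, mul_zero, zero_div] at ha1
    linarith
  have hrel : relationRank p G ≠ 0 := by
    rw [← hr]; exact_mod_cast hr0
  have hψ : ∀ ψ : FreeProP p d → ZMod p, Continuous ψ → (∀ x y, ψ (x * y) = ψ x + ψ y) →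
      ∀ x ∈ φ.ker, ψ x = 0 := fun ψ hc h x hx => additive_eq_zero_of_mem_ker hd hφc hφs hc h hx
  have hstep : ∀ N, d * augDim p (G ⧸ K) N + 1 ≤ augDim p (G ⧸ K) (N + 1) +
      r * augDim p (G ⧸ K) (N + 1 - 2) +
      ∑ k ∈ Finset.range (N + 1), l ^ (k + m) * augDim p (G ⧸ K) (N + 1 - (m + k)) := by
    intro N
    have h1 := golod_shafarevich_step hP hπc hπs φ.ker hker (r := r) hψ
      (by
        rw [hr]
        exact fun V _ _ χ => finrank_le_relationRank_of_extension hφc hφs hrel hψ V χ)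
      (ι := Σ k, Fin (l ^ (k + m))) (fun i => f i.1 i.2)
      (fun i => (hπker _).2 (Subgroup.mem_map_of_mem φ (hSM ⟨i.1, i.2, rfl⟩)))
      (fun i => m + i.1) (fun i => by omega) (fun i => hf i.1 i.2) N
      ((Finset.range (N + 1)).sigma fun _ => Finset.univ)
      (fun i hi => by
        simp only [Finset.mem_sigma, Finset.mem_range, Finset.mem_univ, and_true] at hi
        omega)
      (by
        intro L hLn hLc hRL hfL x hx
        obtain ⟨n, hn, hnx⟩ := (hπker x).1 hx
        have h2 : M ≤ L := Subgroup.topologicalClosure_minimal _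
          (Subgroup.normalClosure_le_normal (by
            rintro _ ⟨k, j, rfl⟩
            exact hfL ⟨k, j⟩)) hLc
        have h3 : n⁻¹ * x ∈ L := hRL (by
          rw [MonoidHom.mem_ker, map_mul, map_inv, hnx, inv_mul_cancel])
        have h4 := L.mul_mem (h2 hn) h3
        rwa [mul_inv_cancel_left] at h4)
    rw [Finset.sum_sigma] at h1
    simpa using h1
  have hla : (l : ℝ) < a := hl ▸ cuttingBase_lt ha1
  have ha0 : 0 < a := by linarith
  have hx0 : 0 ≤ (l : ℝ) / a := by positivity
  have hx1 : (l : ℝ) / a < 1 := (div_lt_one ha0).2 hla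
  refine false_of_golod_shafarevich (c := fun n => (augDim p (G ⧸ K) n : ℝ)) (d := d) (t := a⁻¹)
    (b := fun n => (if n = 2 then (r : ℝ) else 0) + (if m ≤ n then (l : ℝ) ^ n else 0))
    (B := Module.finrank (ZMod p) (MonoidAlgebra (ZMod p) (G ⧸ K)))
    (q := r * a⁻¹ ^ 2 + ((l : ℝ) / a) ^ m / (1 - (l : ℝ) / a))
    (by simp [augDim_zero]) (fun n => Nat.cast_nonneg _)
    (fun n => by exact_mod_cast augDim_le p (G ⧸ K) n) (inv_pos.2 ha0) (inv_lt_one_of_one_lt₀ ha1)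
    ?_ ?_ ?_
  · refine ((hasSum_ite_eq 2 ((r : ℝ) * a⁻¹ ^ 2)).add (hasSum_ite_le_pow hx0 hx1 m)).congr_fun ?_
    intro n
    rw [add_mul]
    congr 1
    · split_ifs with h
      · rw [h]
      · rw [zero_mul]
    · split_ifs
      · rw [div_eq_mul_inv, mul_pow]
      · rw [zero_mul]
  · refine le_of_lt (lt_of_eq_of_lt ?_ hm)
    rw [← add_assoc]
    congr 1
    rw [ha]
    field_simp
    ring
  · intro N
    rw [← sum_range_shift_eq_sum_antidiagonal (fun n => (augDim p (G ⧸ K) n : ℝ))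
      (by simp [augDim_zero]) l m hm2 r N, ← add_assoc]
    exact_mod_cast hstep N
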